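/- Consider four point vortices in the plane at positions $z=(z_1,z_2,z_3,z_4)\in(\mathbb{R}^2)^4$ with circulations $\Gamma_1=\Gamma_2=1$ and $\Gamma_3=\Gamma_4=m$. Let $H(z)=-\sum_{i<j}\Gamma_i\Gamma_j\ln\|z_i-z_j\|$ be the Hamiltonian, let $c=\frac{1}{\Gamma}\sum_i\Gamma_i z_i$ with $\Gamma=\sum_i\Gamma_i$ be the center of vorticity, and let $I(z)=\sum_i\Gamma_i\|z_i-c\|^2$ be the angular impulse. Let $\mathcal{N}=\{z\in\mathbb{R}^8 : c=0,\ I(z)=1\}$, let $\Delta=\{z\in\mathbb{R}^8 : z_i=z_j \text{ for some } i\neq j\}$, and let $\mathcal{M}=(\mathcal{N}\setminus\Delta)/\mathrm{SO}(2)$ be the quotient by simultaneous rotation of all vortices, which is a smooth $4$-dimensional manifold. Then, for each $m$ with $0<m<1$, the function that $H$ induces on $\mathcal{M}$ is a Morse function: it is smooth, and its Hessian is nondegenerate at every critical point. -/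

import Mathlib

open scoped Manifold ContDiff

noncomputable section

namespace Vortex

/-- Positive circulations `Γ₁, …, Γₙ`. -/
structure Circulations (n : ℕ) where
  /-- The circulation of each vortex. -/
  val : Fin n → ℝ
  pos : ∀ i, 0 < val i

/-- The circulations `(1, 1, m, m)`. -/
def pairs (m : ℝ) (hm : 0 < m) : Circulations 4 where
  val := ![1, 1, m, m]
  pos := by intro i; fin_cases i <;> simp [hm]

section Basic

variable {n : ℕ} (Γ : Circulations n)

/-- The Hamiltonian `H(z) = -∑_{i<j} Γᵢ Γⱼ ln ‖zᵢ - zⱼ‖`; the plane is identified with `ℂ`. -/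
def hamiltonian (z : Fin n → ℂ) : ℝ :=
  -∑ i, ∑ j ∈ Finset.Ioi i, Γ.val i * Γ.val j * Real.log ‖z i - z j‖

/-- The center of vorticity. -/
def center (z : Fin n → ℂ) : ℂ :=
  ((∑ i, Γ.val i : ℝ) : ℂ)⁻¹ * ∑ i, (Γ.val i : ℂ) * z i

/-- The angular impulse with respect to the center of vorticity. -/
def impulse (z : Fin n → ℂ) : ℝ :=
  ∑ i, Γ.val i * ‖z i - center Γ z‖ ^ 2

/-- The normalized configuration space `𝒩 = {z : c = 0, I(z) = 1}`. -/
def normalizedSpace : Set (Fin n → ℂ) :=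
  {z | center Γ z = 0 ∧ impulse Γ z = 1}

/-- The collision set `Δ`. -/
def collisionSet (n : ℕ) : Set (Fin n → ℂ) :=
  {z | ∃ i j, i ≠ j ∧ z i = z j}

/-- The space `𝒩 - Δ`, with the subspace topology. -/
abbrev ConfSpace : Type := ↥(normalizedSpace Γ \ collisionSet n)

theorem center_smul (a : ℂ) (z : Fin n → ℂ) :
    center Γ (fun i => a * z i) = a * center Γ z := by
  simp only [center, Finset.mul_sum]
  exact Finset.sum_congr rfl fun i _ => by ring

theorem impulse_smul (a : ℂ) (z : Fin n → ℂ) :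
    impulse Γ (fun i => a * z i) = ‖a‖ ^ 2 * impulse Γ z := by
  simp only [impulse, center_smul, ← mul_sub, norm_mul, Finset.mul_sum]
  exact Finset.sum_congr rfl fun i _ => by ring

/-- `SO(2)`, realized as the unit circle of `ℂ`, acts on `𝒩 - Δ` by rotating all vortices. -/
instance : MulAction Circle (ConfSpace Γ) where
  smul g z := ⟨fun i => (g : ℂ) * z.1 i, by
    obtain ⟨z, ⟨hc, hI⟩, hΔ⟩ := z
    refine ⟨⟨?_, ?_⟩, ?_⟩
    · rw [center_smul, hc, mul_zero]
    · rw [impulse_smul, hI, Circle.norm_coe]; norm_num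
    · rintro ⟨i, j, hij, h⟩
      exact hΔ ⟨i, j, hij, mul_left_cancel₀ g.coe_ne_zero h⟩⟩
  one_smul z := Subtype.ext (funext fun i => by
    change ((1 : Circle) : ℂ) * z.1 i = z.1 i
    simp)
  mul_smul g h z := Subtype.ext (funext fun i => by
    change ((g * h : Circle) : ℂ) * z.1 i = (g : ℂ) * ((h : ℂ) * z.1 i)
    rw [Circle.coe_mul, mul_assoc])

theorem smul_apply (g : Circle) (z : ConfSpace Γ) (i : Fin n) :
    (g • z).1 i = (g : ℂ) * z.1 i := rfl

/-- The quotient space `ℳ = (𝒩 - Δ) / SO(2)`, with the quotient topology. -/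
def Reduced : Type := MulAction.orbitRel.Quotient Circle (ConfSpace Γ)

instance : TopologicalSpace (Reduced Γ) :=
  inferInstanceAs (TopologicalSpace (Quotient (MulAction.orbitRel Circle (ConfSpace Γ))))

/-- The projection `𝒩 - Δ → ℳ`. -/
def proj (z : ConfSpace Γ) : Reduced Γ :=
  Quotient.mk (MulAction.orbitRel Circle (ConfSpace Γ)) z

theorem continuous_proj : Continuous (proj Γ) := continuous_quotient_mk'

theorem proj_surjective : Function.Surjective (proj Γ) := Quotient.mk_surjective

/-- The function induced by the Hamiltonian on the quotient `ℳ`. -/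
def reducedHamiltonian : Reduced Γ → ℝ :=
  Quotient.lift (fun z : ConfSpace Γ => hamiltonian Γ z.1) (by
    rintro _ z ⟨g, rfl⟩
    simp only [hamiltonian, smul_apply, ← mul_sub, norm_mul, Circle.norm_coe, one_mul])

end Basic

section SmoothStructure

/-! ### The smooth structure of the quotient

Away from collisions the shape coordinates `wⱼ = (zⱼ - z₁)/(z₂ - z₁)`, `3 ≤ j ≤ n`, form a
global chart of `ℳ`. They are smooth in `z` and have a smooth section `rep`
(`contDiffOn_shapeCoord`, `contDiff_rep`, `shapeCoord_rep`),
so this is the smooth structure for which the projection `𝒩 - Δ → ℳ` is a submersion. -/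

variable {k : ℕ} (Γ : Circulations (k + 2))

/-- The configuration `(0, 1, w₃, …, wₙ)`. -/
def frame (w : Fin k → ℂ) : Fin (k + 2) → ℂ :=
  Matrix.vecCons 0 (Matrix.vecCons 1 w)

/-- The shape coordinates of a configuration. -/
def shapeCoord (z : Fin (k + 2) → ℂ) (j : Fin k) : ℂ :=
  (z j.succ.succ - z 0) / (z 1 - z 0)

/-- The collision-free shapes. -/
def shapes (k : ℕ) : Set (Fin k → ℂ) :=
  {w | frame w ∉ collisionSet (k + 2)}

/-- The configuration `(0, 1, w₃, …, wₙ)`, translated and scaled to lie in `𝒩`. -/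
def rep (w : Fin k → ℂ) (i : Fin (k + 2)) : ℂ :=
  (((Real.sqrt (impulse Γ (frame w)))⁻¹ : ℝ) : ℂ) * (frame w i - center Γ (frame w))

theorem sum_pos' : 0 < ∑ i, Γ.val i :=
  Finset.sum_pos (fun i _ => Γ.pos i) Finset.univ_nonempty

theorem center_affine (a b : ℂ) (z : Fin (k + 2) → ℂ) :
    center Γ (fun i => a * z i + b) = a * center Γ z + b := by
  have h : ((∑ i, Γ.val i : ℝ) : ℂ) ≠ 0 := by exact_mod_cast (sum_pos' Γ).ne'
  have h1 : ∑ i, (Γ.val i : ℂ) * (a * z i + b)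
      = a * (∑ i, (Γ.val i : ℂ) * z i) + ((∑ i, Γ.val i : ℝ) : ℂ) * b := by
    push_cast
    rw [Finset.mul_sum, Finset.sum_mul, ← Finset.sum_add_distrib]
    exact Finset.sum_congr rfl fun i _ => by ring
  rw [center, center, h1]
  field_simp

theorem impulse_affine (a b : ℂ) (z : Fin (k + 2) → ℂ) :
    impulse Γ (fun i => a * z i + b) = ‖a‖ ^ 2 * impulse Γ z := by
  simp only [impulse, center_affine, add_sub_add_right_eq_sub, ← mul_sub, norm_mul,
    Finset.mul_sum]
  exact Finset.sum_congr rfl fun i _ => by ring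

theorem impulse_frame_pos (w : Fin k → ℂ) : 0 < impulse Γ (frame w) := by
  have hnn : ∀ i, 0 ≤ Γ.val i * ‖frame w i - center Γ (frame w)‖ ^ 2 := fun i =>
    mul_nonneg (Γ.pos i).le (sq_nonneg _)
  refine lt_of_le_of_ne (Finset.sum_nonneg fun i _ => hnn i) fun h => ?_
  have h0 := (Finset.sum_eq_zero_iff_of_nonneg fun i _ => hnn i).1 h.symm
  have key : ∀ i, frame w i = center Γ (frame w) := fun i => by
    have := h0 i (Finset.mem_univ i)
    simpa [(Γ.pos i).ne', sub_eq_zero] using this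
  have h01 : frame w 0 = frame w 1 := (key 0).trans (key 1).symm
  simp [frame] at h01

theorem sqrt_impulse_pos (w : Fin k → ℂ) : 0 < Real.sqrt (impulse Γ (frame w)) :=
  Real.sqrt_pos.2 (impulse_frame_pos Γ w)

theorem rep_mem {w : Fin k → ℂ} (hw : w ∈ shapes k) :
    rep Γ w ∈ normalizedSpace Γ \ collisionSet (k + 2) := by
  have hs := sqrt_impulse_pos Γ w
  have hI := Real.sq_sqrt (impulse_frame_pos Γ w).le
  have hrep : rep Γ w = fun i =>
      (((Real.sqrt (impulse Γ (frame w)))⁻¹ : ℝ) : ℂ) * frame w i +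
        -((((Real.sqrt (impulse Γ (frame w)))⁻¹ : ℝ) : ℂ) * center Γ (frame w)) := by
    funext i; rw [rep]; ring
  refine ⟨⟨?_, ?_⟩, ?_⟩
  · rw [hrep, center_affine]; ring
  · rw [hrep, impulse_affine, Complex.norm_real, Real.norm_eq_abs, sq_abs, inv_pow, hI]
    exact inv_mul_cancel₀ (impulse_frame_pos Γ w).ne'
  · rintro ⟨i, j, hij, h⟩
    refine hw ⟨i, j, hij, ?_⟩
    have hne : (((Real.sqrt (impulse Γ (frame w)))⁻¹ : ℝ) : ℂ) ≠ 0 := by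
      exact_mod_cast (inv_pos.2 hs).ne'
    simpa [rep] using mul_left_cancel₀ hne h

theorem shapeCoord_rep (w : Fin k → ℂ) : shapeCoord (rep Γ w) = w := by
  have hne : (((Real.sqrt (impulse Γ (frame w)))⁻¹ : ℝ) : ℂ) ≠ 0 := by
    exact_mod_cast (inv_pos.2 (sqrt_impulse_pos Γ w)).ne'
  funext j
  have h0 : frame w 0 = 0 := rfl
  have h1 : frame w 1 = 1 := rfl
  have hj : frame w j.succ.succ = w j := rfl
  simp only [shapeCoord, rep, ← mul_sub, sub_sub_sub_cancel_right, h0, h1, hj, sub_zero, mul_one]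
  exact mul_div_cancel_left₀ _ hne

theorem eq_affine_frame {z : Fin (k + 2) → ℂ} (hz : z 1 - z 0 ≠ 0) :
    z = fun i => (z 1 - z 0) * frame (shapeCoord z) i + z 0 := by
  funext i
  refine Fin.cases ?_ (fun i => Fin.cases ?_ (fun j => ?_) i) i
  · change z 0 = (z 1 - z 0) * 0 + z 0
    ring
  · change z 1 = (z 1 - z 0) * 1 + z 0
    ring
  · change z j.succ.succ = (z 1 - z 0) * ((z j.succ.succ - z 0) / (z 1 - z 0)) + z 0
    rw [mul_div_cancel₀ _ hz]
    ring

theorem sub_ne_zero_of_conf (z : ConfSpace Γ) : z.1 1 - z.1 0 ≠ 0 := fun h =>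
  z.2.2 ⟨1, 0, by simp, sub_eq_zero.1 h⟩

theorem shapeCoord_mem (z : ConfSpace Γ) : shapeCoord z.1 ∈ shapes k := by
  rintro ⟨i, j, hij, h⟩
  refine z.2.2 ⟨i, j, hij, ?_⟩
  rw [eq_affine_frame (sub_ne_zero_of_conf Γ z)]
  simp only [h]

theorem shapeCoord_smul (g : Circle) (z : ConfSpace Γ) :
    shapeCoord (g • z).1 = shapeCoord z.1 := by
  funext j
  simp only [shapeCoord, smul_apply, ← mul_sub]
  exact mul_div_mul_left _ _ g.coe_ne_zero

theorem proj_rep_shapeCoord (z : ConfSpace Γ) :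
    proj Γ ⟨rep Γ (shapeCoord z.1), rep_mem Γ (shapeCoord_mem Γ z)⟩ = proj Γ z := by
  have hne := sub_ne_zero_of_conf Γ z
  have haff := eq_affine_frame hne
  set a := z.1 1 - z.1 0 with ha
  set F := frame (shapeCoord z.1) with hF
  have hc : a * center Γ F + z.1 0 = 0 := by
    rw [← center_affine, ← haff]; exact z.2.1.1
  have hI : ‖a‖ ^ 2 * impulse Γ F = 1 := by
    rw [← impulse_affine Γ a (z.1 0), ← haff]; exact z.2.1.2
  have hs : ‖a‖ = (Real.sqrt (impulse Γ F))⁻¹ := by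
    refine eq_inv_of_mul_eq_one_left ?_
    have h2 : (‖a‖ * Real.sqrt (impulse Γ F)) ^ 2 = 1 := by
      rw [mul_pow, Real.sq_sqrt (impulse_frame_pos Γ _).le, hI]
    exact (pow_eq_one_iff_of_nonneg (by positivity) two_ne_zero).1 h2
  have hna : (‖a‖ : ℂ) ≠ 0 := by exact_mod_cast (norm_pos_iff.2 hne).ne'
  have hg : ‖(‖a‖ : ℂ) / a‖ = 1 := by
    rw [norm_div, Complex.norm_real, norm_norm, div_self (norm_pos_iff.2 hne).ne']
  refine Quotient.sound ⟨⟨(‖a‖ : ℂ) / a, mem_sphere_zero_iff_norm.2 hg⟩, ?_⟩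
  refine Subtype.ext (funext fun i => ?_)
  change (‖a‖ : ℂ) / a * z.1 i = rep Γ (shapeCoord z.1) i
  rw [congrFun haff i, rep, ← hF, ← hs, eq_neg_of_add_eq_zero_right hc]
  field_simp
  ring

theorem isOpen_shapes : IsOpen (shapes k) := by
  have hcont : ∀ i, Continuous fun w : Fin k → ℂ => frame w i := fun i => by
    refine Fin.cases continuous_const (fun i => ?_) i
    exact Fin.cases continuous_const (fun j => continuous_apply j) i
  have : shapes k = ⋂ i, ⋂ j, {w | i ≠ j → frame w i ≠ frame w j} := by
    ext w; simp [shapes, collisionSet]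
  rw [this]
  refine isOpen_iInter_of_finite fun i => isOpen_iInter_of_finite fun j => ?_
  by_cases hij : i = j
  · simp [hij]
  · simpa [hij] using isOpen_ne_fun (hcont i) (hcont j)

theorem contDiff_frame (i : Fin (k + 2)) :
    ContDiff ℝ ∞ fun w : Fin k → ℂ => frame w i := by
  refine Fin.cases contDiff_const (fun i => ?_) i
  exact Fin.cases contDiff_const (fun j => contDiff_apply ℝ ℂ j) i

theorem contDiff_center_frame : ContDiff ℝ ∞ fun w : Fin k → ℂ => center Γ (frame w) :=
  contDiff_const.mul (ContDiff.sum fun i _ => contDiff_const.mul (contDiff_frame i))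

theorem contDiff_impulse_frame : ContDiff ℝ ∞ fun w : Fin k → ℂ => impulse Γ (frame w) :=
  ContDiff.sum fun i _ =>
    contDiff_const.mul (((contDiff_frame i).sub (contDiff_center_frame Γ)).norm_sq ℝ)

theorem contDiff_rep : ContDiff ℝ ∞ (rep Γ) := by
  refine contDiff_pi.2 fun i => ?_
  have h1 : ContDiff ℝ ∞ fun w : Fin k → ℂ => (Real.sqrt (impulse Γ (frame w)))⁻¹ :=
    ((contDiff_impulse_frame Γ).sqrt fun w => (impulse_frame_pos Γ w).ne').inv
      fun w => (sqrt_impulse_pos Γ w).ne'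
  exact (Complex.ofRealCLM.contDiff.comp h1).mul
    ((contDiff_frame i).sub (contDiff_center_frame Γ))

theorem contDiffOn_shapeCoord :
    ContDiffOn ℝ ∞ (shapeCoord (k := k)) {z | z 1 ≠ z 0} := by
  refine contDiffOn_pi.2 fun j => ?_
  have h : ∀ i j : Fin (k + 2), ContDiffOn ℝ ∞ (fun z : Fin (k + 2) → ℂ => z i - z j)
      {z | z 1 ≠ z 0} := fun i j =>
    ((contDiff_apply ℝ ℂ i).sub (contDiff_apply ℝ ℂ j)).contDiffOn
  simp only [shapeCoord, div_eq_mul_inv]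
  exact (h _ _).mul ((h 1 0).inv fun z hz => sub_ne_zero.2 hz)

theorem base_mem : (fun j : Fin k => ((j : ℕ) : ℂ) + 2) ∈ shapes k := by
  have h : ∀ i : Fin (k + 2),
      frame (fun j : Fin k => ((j : ℕ) : ℂ) + 2) i = ((i : ℕ) : ℂ) := fun i => by
    refine Fin.cases ?_ (fun i => Fin.cases ?_ (fun j => ?_) i) i
    · simp [frame]
    · simp [frame]
    · simp [frame]; ring
  rintro ⟨i, j, hij, he⟩
  rw [h, h] at he
  exact hij (Fin.ext (by exact_mod_cast he))

open Classical in
/-- The global chart of `ℳ` given by the shape coordinates. (The value of the inverse outside the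
target is irrelevant.) -/
def shapeChart : OpenPartialHomeomorph (Reduced Γ) (Fin k → ℂ) where
  toFun := Quotient.lift (fun z : ConfSpace Γ => shapeCoord z.1) (by
    rintro _ z ⟨g, rfl⟩
    exact shapeCoord_smul Γ g z)
  invFun w := if hw : w ∈ shapes k then proj Γ ⟨rep Γ w, rep_mem Γ hw⟩
    else proj Γ ⟨_, rep_mem Γ base_mem⟩
  source := Set.univ
  target := shapes k
  map_source' := by
    rintro x -
    obtain ⟨z, rfl⟩ := proj_surjective Γ x
    exact shapeCoord_mem Γ z
  map_target' _ _ := Set.mem_univ _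
  left_inv' := by
    rintro x -
    obtain ⟨z, rfl⟩ := proj_surjective Γ x
    change (if hw : shapeCoord z.1 ∈ shapes k then proj Γ ⟨_, rep_mem Γ hw⟩
      else proj Γ ⟨_, rep_mem Γ base_mem⟩) = proj Γ z
    rw [dif_pos (shapeCoord_mem Γ z)]
    exact proj_rep_shapeCoord Γ z
  right_inv' := by
    intro w hw
    simp only [dif_pos hw]
    exact shapeCoord_rep Γ w
  open_source := isOpen_univ
  open_target := isOpen_shapes
  continuousOn_toFun := by
    refine Continuous.continuousOn (Continuous.quotient_lift ?_ _)
    exact contDiffOn_shapeCoord.continuousOn.comp_continuous continuous_subtype_val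
      fun z => sub_ne_zero.1 (sub_ne_zero_of_conf Γ z)
  continuousOn_invFun := by
    rw [continuousOn_iff_continuous_domRestrict]
    have : Continuous fun w : shapes k => proj Γ ⟨rep Γ w.1, rep_mem Γ w.2⟩ :=
      (continuous_proj Γ).comp
        (((contDiff_rep Γ).continuous.comp continuous_subtype_val).subtype_mk _)
    convert this using 2 with w
    simp [w.2]

/-- The manifold structure on `ℳ`, of real dimension `2 k = 2 n - 4` for `n = k + 2` vortices. -/
instance : ChartedSpace (Fin k → ℂ) (Reduced Γ) :=
  (shapeChart Γ).singletonChartedSpace rfl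

instance : IsManifold 𝓘(ℝ, Fin k → ℂ) ∞ (Reduced Γ) :=
  (shapeChart Γ).isManifold_singleton rfl

end SmoothStructure

section Morse

variable {E : Type*} [NormedAddCommGroup E] [NormedSpace ℝ E] [FiniteDimensional ℝ E]
  {M : Type*} [TopologicalSpace M] [ChartedSpace E M]

/-- The matrix of second partial derivatives, as a bilinear form, of `f` in the preferred chart
at `p`. -/
def chartHessian (f : M → ℝ) (p : M) : E →L[ℝ] E →L[ℝ] ℝ :=
  fderiv ℝ (fderiv ℝ (f ∘ (extChartAt 𝓘(ℝ, E) p).symm)) (extChartAt 𝓘(ℝ, E) p p)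

/-- `p` is a critical point of `f`. -/
def IsCriticalPoint (f : M → ℝ) (p : M) : Prop :=
  mfderiv 𝓘(ℝ, E) 𝓘(ℝ, ℝ) f p = 0

/-- A Morse function: smooth, with nondegenerate Hessian at each critical point (a condition that
does not depend on the chart). -/
def IsMorse (f : M → ℝ) : Prop :=
  ContMDiff 𝓘(ℝ, E) 𝓘(ℝ, ℝ) ∞ f ∧
    ∀ p : M, IsCriticalPoint (E := E) f p →
      ∀ v : E, (∀ u : E, chartHessian f p v u = 0) → v = 0

end Morse

end Vortex

end

/-!
In the chart the reduced Hamiltonian is, up to a constant, the scale-invariant energy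
`-½ ∑_{i<j} Γᵢ Γⱼ log sᵢⱼ + ½ L log J`, where `sᵢⱼ` are the squared distances,
`L = ∑_{i<j} Γᵢ Γⱼ` and `J = ∑_{i<j} Γᵢ Γⱼ sᵢⱼ`. Its critical points are the solutions of
`∑ⱼ Cᵢⱼ (zᵢ - zⱼ) = 0` with `Cᵢⱼ = Γᵢ Γⱼ (sᵢⱼ⁻¹ - ν)`, `ν = L / J`, and a vector in the kernel of
the Hessian extends such a solution to one over the dual numbers `ℝ[ε]`. So it suffices that
solutions over `ℝ[ε]` normalised by `z₀ = 0`, `z₁ = 1` have no `ε`-part. Collinear solutions are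
handled by two maximum principles, one for the normal and one for the tangential variation.
For non-collinear ones, Dziobek's relation `Cᵢⱼ = κ Aᵢ Aⱼ` with signed areas `Aᵢ` and `κ < 0` gives,
after the rescaling `aᵢ = r Aᵢ / Γᵢ`, `r² = -κ / ν`, the equations `ν sᵢⱼ (1 - aᵢ aⱼ) = 1`. This
algebraic system in the `aᵢ` is then shown to be nondegenerate by cases on whether `a₀ = a₁` and
`a₂ = a₃`.
-/

noncomputable section

namespace Vortex

open TrivSqZeroExt DualNumber

/-! ### Dual numbers -/

section DualNumbers

variable {K : Type*} [Field K] {x y z : K[ε]}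

theorem fst_ofNat (n : ℕ) [n.AtLeastTwo] : (ofNat(n) : K[ε]).fst = ofNat(n) :=
  fst_natCast n

theorem snd_ofNat (n : ℕ) [n.AtLeastTwo] : (ofNat(n) : K[ε]).snd = 0 :=
  snd_natCast n

theorem inl_ofNat (n : ℕ) [n.AtLeastTwo] : (inl ofNat(n) : K[ε]) = ofNat(n) :=
  inl_natCast n

theorem isUnit_of_fst_ne_zero (hx : x.fst ≠ 0) : IsUnit x :=
  isUnit_iff_isUnit_fst.2 hx.isUnit

theorem eq_zero_of_fst_ne_zero_of_mul_left (hx : x.fst ≠ 0) (h : x * y = 0) : y = 0 :=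
  (isUnit_of_fst_ne_zero hx).mul_right_eq_zero.1 h

theorem eq_zero_of_fst_ne_zero_of_mul_right (hy : y.fst ≠ 0) (h : x * y = 0) : x = 0 :=
  (isUnit_of_fst_ne_zero hy).mul_left_eq_zero.1 h

theorem snd_eq_zero_of_quadratic {a b c : K} (hd : discrim a b c ≠ 0)
    (h : inl a * (x * x) + inl b * x + inl c = 0) : x.snd = 0 := by
  have h0 : a * (x.fst * x.fst) + b * x.fst + c = 0 := by simpa using congrArg fst h
  have h1 : (2 * a * x.fst + b) * x.snd = 0 := by
    have := congrArg snd h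
    simp only [snd_add, snd_zero, DualNumber.snd_mul, fst_inl, snd_inl, fst_mul] at this
    linear_combination this
  rw [discrim_eq_sq_of_quadratic_eq_zero h0] at hd
  exact (mul_eq_zero.1 h1).resolve_left fun h => hd (by rw [h, zero_pow two_ne_zero])

theorem snd_eq_zero_of_snd_mul_self [CharZero K] (hx : x.fst ≠ 0) (h : (x * x).snd = 0) :
    x.snd = 0 := by
  have : 2 * (x.fst * x.snd) = 0 := by
    rw [DualNumber.snd_mul] at h
    linear_combination h
  simpa [hx] using this

theorem snd_eq_zero_of_snd_add_of_snd_mul (hxy : x.fst ≠ y.fst) (hs : (x + y).snd = 0)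
    (hp : (x * y).snd = 0) : x.snd = 0 ∧ y.snd = 0 := by
  rw [snd_add] at hs
  rw [DualNumber.snd_mul] at hp
  have h : (x.fst - y.fst) * x.snd = 0 := by linear_combination x.fst * hs - hp
  have hx : x.snd = 0 := (mul_eq_zero.1 h).resolve_left (sub_ne_zero.2 hxy)
  exact ⟨hx, by rwa [hx, zero_add] at hs⟩

theorem exists_mul_self_eq {q : ℝ[ε]} (hq : 0 < q.fst) : ∃ r : ℝ[ε], r * r = q := by
  have h := (Real.sqrt_pos.2 hq).ne'
  refine ⟨inl √q.fst + inr (q.snd / (2 * √q.fst)), ?_⟩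
  ext
  · simp [Real.mul_self_sqrt hq.le]
  · simp only [DualNumber.snd_mul, fst_add, snd_add, fst_inl, snd_inl, fst_inr, snd_inr]
    field_simp
    ring

end DualNumbers

/-! ### Equilibrium equations -/

section PairSum

variable {n : ℕ} {S : Type*}

/-- The sum over all pairs `i < j`. -/
def pairSum [AddCommMonoid S] (f : Fin n → Fin n → S) : S :=
  ∑ i, ∑ j ∈ Finset.Ioi i, f i j

theorem pairSum_congr [AddCommMonoid S] {f g : Fin n → Fin n → S}
    (h : ∀ i j, i ≠ j → f i j = g i j) : pairSum f = pairSum g :=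
  Finset.sum_congr rfl fun _ _ => Finset.sum_congr rfl fun _ hj => h _ _ (Finset.mem_Ioi.1 hj).ne

theorem mul_pairSum [NonUnitalNonAssocSemiring S] (a : S) (f : Fin n → Fin n → S) :
    a * pairSum f = pairSum fun i j => a * f i j := by
  simp only [pairSum, Finset.mul_sum]

theorem pairSum_sub [AddCommGroup S] (f g : Fin n → Fin n → S) :
    (pairSum fun i j => f i j - g i j) = pairSum f - pairSum g := by
  simp only [pairSum, Finset.sum_sub_distrib]

theorem pairSum_pos {k : ℕ} {f : Fin (k + 2) → Fin (k + 2) → ℝ} (h : ∀ i j, i ≠ j → 0 < f i j) :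
    0 < pairSum f := by
  have hf (i j) (hj : j ∈ Finset.Ioi i) : 0 < f i j := h i j (Finset.mem_Ioi.1 hj).ne
  refine Finset.sum_pos' (fun i _ => Finset.sum_nonneg fun j hj => (hf i j hj).le)
    ⟨0, Finset.mem_univ 0, Finset.sum_pos (hf 0) ⟨1, ?_⟩⟩
  simp

theorem sum_sum_eq_pairSum [AddCommMonoid S] {f : Fin n → Fin n → S} (h : ∀ i, f i i = 0) :
    ∑ i, ∑ j, f i j = pairSum fun i j => f i j + f j i := by
  simp only [pairSum, Finset.sum_sum_Ioi_add_eq_sum_sum_off_diag fun i j => f j i]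
  refine Finset.sum_congr rfl fun i _ => ?_
  rw [Fintype.sum_eq_add_sum_compl i, h, zero_add]

end PairSum

section Force

variable {ι S : Type*} [CommRing S]

/-- The squared distance between the points with coordinates `(X i, Y i)` and `(X j, Y j)`. -/
def sqDist (X Y : ι → S) (i j : ι) : S := (X i - X j) ^ 2 + (Y i - Y j) ^ 2

theorem sqDist_comm (X Y : ι → S) (i j : ι) : sqDist X Y i j = sqDist X Y j i := by
  simp only [sqDist]; ring

theorem sqDist_self (X Y : ι → S) (i : ι) : sqDist X Y i i = 0 := by simp [sqDist]

/-- One coordinate of the total force on the point `i` when `i` is pulled towards `j` by a spring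
of stiffness `C i j`, up to sign. -/
def force [Fintype ι] (C : ι → ι → S) (X : ι → S) (i : ι) : S := ∑ j, C i j * (X i - X j)

variable {n : ℕ} {C : Fin n → Fin n → S}

theorem sum_mul_force (hC : ∀ i j, C i j = C j i) (X U : Fin n → S) :
    ∑ i, U i * force C X i = pairSum fun i j => C i j * ((X i - X j) * (U i - U j)) := by
  simp only [force, Finset.mul_sum]
  rw [sum_sum_eq_pairSum fun i => by ring]
  exact pairSum_congr fun i j _ => by rw [hC j i]; ring

theorem sum_force (hC : ∀ i j, C i j = C j i) (X : Fin n → S) : ∑ i, force C X i = 0 := by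
  have h := sum_mul_force hC X 1
  simpa [pairSum] using h

end Force

section Equilibrium

/-- The equations of a relative equilibrium of vortices with circulations `g i` at the points
`(X i, Y i)`, over a commutative ring. The factor `C i j` stands for
`g i * g j * (1 / sqDist X Y i j - ν)`. Over `ℝ[ε]` a solution is a real solution together with a
solution of the linearized equations. -/
structure Equilibrium {ι S : Type*} [Fintype ι] [CommRing S] (g X Y : ι → S) (C : ι → ι → S)
    (ν : S) : Prop where
  coupling_comm : ∀ i j, C i j = C j i
  coupling_mul_sqDist : ∀ i j, i ≠ j →
    C i j * sqDist X Y i j = g i * g j * (1 - ν * sqDist X Y i j)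
  force_fst : ∀ i, force C X i = 0
  force_snd : ∀ i, force C Y i = 0

/-- Two distinguished points are placed at `(0, 0)` and `(1, 0)`, which removes the freedom of
applying similarities. -/
structure Anchored {k : ℕ} {S : Type*} [CommRing S] (X Y : Fin (k + 2) → S) : Prop where
  fst_zero : X 0 = 0
  snd_zero : Y 0 = 0
  fst_one : X 1 = 1
  snd_one : Y 1 = 0

variable {k : ℕ} {S : Type*} [CommRing S] {X Y : Fin (k + 2) → S}
  {C : Fin (k + 2) → Fin (k + 2) → S}

/-- Invariance under translations, rotations and dilations (the last one is `hscale`) makes the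
equations of two of the points redundant. -/
theorem Anchored.force_eq_zero (hA : Anchored X Y) (hC : ∀ i j, C i j = C j i)
    (hscale : pairSum (fun i j => C i j * sqDist X Y i j) = 0)
    (hX : ∀ j : Fin k, force C X j.succ.succ = 0) (hY : ∀ j : Fin k, force C Y j.succ.succ = 0) :
    (∀ i, force C X i = 0) ∧ ∀ i, force C Y i = 0 := by
  have htrans (Z : Fin (k + 2) → S) (hZ : ∀ j : Fin k, force C Z j.succ.succ = 0) :
      force C Z 0 + force C Z 1 = 0 := by
    simpa [Fin.sum_univ_succ, hZ] using sum_force hC Z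
  have hweight (U Z : Fin (k + 2) → S) (hZ : ∀ j : Fin k, force C Z j.succ.succ = 0) :
      ∑ i, U i * force C Z i = U 0 * force C Z 0 + U 1 * force C Z 1 := by
    simp [Fin.sum_univ_succ, hZ]
  have hrot : force C Y 1 = 0 := by
    have h : ∑ i, X i * force C Y i = ∑ i, Y i * force C X i := by
      rw [sum_mul_force hC, sum_mul_force hC]
      exact pairSum_congr fun i j _ => by ring
    rw [hweight X Y hY, hweight Y X hX, hA.fst_zero, hA.snd_zero, hA.fst_one, hA.snd_one] at h
    linear_combination h
  have hdil : force C X 1 = 0 := by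
    have h : ∑ i, X i * force C X i + ∑ i, Y i * force C Y i = 0 := by
      rw [sum_mul_force hC, sum_mul_force hC, ← hscale]
      simp only [pairSum, ← Finset.sum_add_distrib]
      exact pairSum_congr fun i j _ => by rw [sqDist]; ring
    rw [hweight X X hX, hweight Y Y hY, hA.fst_zero, hA.snd_zero, hA.fst_one, hA.snd_one] at h
    linear_combination h
  constructor
  · refine Fin.cases ?_ (Fin.cases hdil hX)
    linear_combination htrans X hX - hdil
  · refine Fin.cases ?_ (Fin.cases hrot hY)
    linear_combination htrans Y hY - hrot

end Equilibrium

/-! ### The equations of the signed areas -/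

/-- The equations satisfied by the normalized signed areas `a i` of a non-collinear equilibrium
with circulations `g i`; the entry `e i j` is the normalized squared distance between the points
`i` and `j`, which is inverse to `1 - a i * a j`. -/
structure AreaSystem {ι S : Type*} [Fintype ι] [CommRing S] (g a : ι → S) (e : ι → ι → S)
    (t : S) : Prop where
  sum_mul : ∑ i, g i * a i = 0
  symm : ∀ i j, e i j = e j i
  self : ∀ i, e i i = 0
  mul_one_sub : ∀ i j, i ≠ j → e i j * (1 - a i * a j) = 1
  balance : ∀ i, ∑ j, g j * a j * e i j = t

namespace AreaSystem

section Algebra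

variable {ι S T : Type*} [Fintype ι] [CommRing S] [CommRing T] {g a : ι → S} {e : ι → ι → S}
  {t : S}

theorem map (f : S →+* T) (H : AreaSystem g a e t) :
    AreaSystem (fun i => f (g i)) (fun i => f (a i)) (fun i j => f (e i j)) (f t) where
  sum_mul := by simpa using congrArg f H.sum_mul
  symm i j := by rw [H.symm]
  self i := by rw [H.self, map_zero]
  mul_one_sub i j hij := by simpa using congrArg f (H.mul_one_sub i j hij)
  balance i := by simpa using congrArg f (H.balance i)

theorem reindex (σ : ι ≃ ι) (H : AreaSystem g a e t) :
    AreaSystem (fun i => g (σ i)) (fun i => a (σ i)) (fun i j => e (σ i) (σ j)) t where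
  sum_mul := (σ.sum_comp fun i => g i * a i).trans H.sum_mul
  symm _ _ := H.symm _ _
  self _ := H.self _
  mul_one_sub _ _ hij := H.mul_one_sub _ _ (σ.injective.ne hij)
  balance _ := (σ.sum_comp fun j => g j * a j * e _ j).trans (H.balance _)

theorem apply_eq_of_eq (H : AreaSystem g a e t) {i j k : ι} (hij : a i = a j) (hik : i ≠ k)
    (hjk : j ≠ k) : e i k = e j k := by
  have hi := H.mul_one_sub i k hik
  have hj := H.mul_one_sub j k hjk
  rw [hij] at hi
  linear_combination e j k * hi - e i k * hj

theorem mul_mul_one_sub (H : AreaSystem g a e t) {i j k l : ι} (hij : i ≠ j) (hkl : k ≠ l) :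
    e i j * e k l * ((1 - a i * a j) * (1 - a k * a l)) = 1 := by
  rw [mul_mul_mul_comm, H.mul_one_sub i j hij, H.mul_one_sub k l hkl, one_mul]

theorem sub_mul_eq_zero (H : AreaSystem g a e t) {i j : ι} (hij : i ≠ j) (hg : g i = g j) :
    (a i - a j) * (∑ k, g k * a k ^ 2 * (e i k * e j k) - g i * e i j) = 0 := by
  classical
  have hterm (k : ι) : (a i - a j) * (g k * a k ^ 2 * (e i k * e j k)) =
      g k * a k * e i k - g k * a k * e j k + (if k = i then g i * a i * e i j else 0)
        - if k = j then g i * a j * e i j else 0 := by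
    rcases eq_or_ne k i with rfl | hi
    · simp [H.self, hij, H.symm j]
    rcases eq_or_ne k j with rfl | hj
    · simp [H.self, hi, hg]
    rw [if_neg hi, if_neg hj]
    linear_combination g k * a k * (e i k * H.mul_one_sub j k hj.symm
      - e j k * H.mul_one_sub i k hi.symm)
  rw [mul_sub, Finset.mul_sum, Finset.sum_congr rfl fun k _ => hterm k]
  simp only [Finset.sum_sub_distrib, Finset.sum_add_distrib, H.balance, Finset.sum_ite_eq',
    Finset.mem_univ, if_true]
  ring

end Algebra

section Pairs

variable {S T : Type*} [CommRing S] [CommRing T] {g h t : S} {a : Fin 4 → S}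
  {e : Fin 4 → Fin 4 → S}

theorem map_pairs (f : S →+* T) (H : AreaSystem ![g, g, h, h] a e t) :
    AreaSystem ![f g, f g, f h, f h] (fun i => f (a i)) (fun i j => f (e i j)) (f t) := by
  have hf : ![f g, f g, f h, f h] = fun i => f (![g, g, h, h] i) := by
    funext i
    fin_cases i <;> rfl
  rw [hf]
  exact H.map f

theorem swap (H : AreaSystem ![g, g, h, h] a e t) :
    AreaSystem ![h, h, g, g] (fun i => a (i + 2)) (fun i j => e (i + 2) (j + 2)) t := by
  have hswap : ![h, h, g, g] = fun i => ![g, g, h, h] (Equiv.addRight 2 i) := by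
    funext i
    fin_cases i <;> rfl
  rw [hswap]
  exact H.reindex (Equiv.addRight 2)

theorem sum_mul_pairs (H : AreaSystem ![g, g, h, h] a e t) :
    g * (a 0 + a 1) + h * (a 2 + a 3) = 0 := by
  have := H.sum_mul
  simp only [Fin.sum_univ_four, Matrix.cons_val] at this
  linear_combination this

theorem sub_mul_eq_zero_left (H : AreaSystem ![g, g, h, h] a e t) :
    (a 0 - a 1) * (h * (a 2 ^ 2 * (e 0 2 * e 1 2) + a 3 ^ 2 * (e 0 3 * e 1 3)) - g * e 0 1) =
      0 := by
  have := H.sub_mul_eq_zero (i := 0) (j := 1) (by decide) rfl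
  simp only [Fin.sum_univ_four, Matrix.cons_val, H.self] at this
  linear_combination this

theorem sub_mul_eq_zero_right (H : AreaSystem ![g, g, h, h] a e t) :
    (a 2 - a 3) * (g * (a 0 ^ 2 * (e 0 2 * e 0 3) + a 1 ^ 2 * (e 1 2 * e 1 3)) - h * e 2 3) =
      0 := by
  rw [H.symm 0 2, H.symm 0 3, H.symm 1 2, H.symm 1 3]
  exact H.swap.sub_mul_eq_zero_left

theorem balance_pairs (H : AreaSystem ![g, g, h, h] a e t) :
    g * (a 0 + a 1) * e 0 1 + h * (a 2 * (e 0 2 + e 1 2) + a 3 * (e 0 3 + e 1 3)) =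
      h * (a 2 + a 3) * e 2 3 + g * (a 0 * (e 0 2 + e 0 3) + a 1 * (e 1 2 + e 1 3)) := by
  have h0 := H.balance 0
  have h1 := H.balance 1
  have h2 := H.balance 2
  have h3 := H.balance 3
  simp only [Fin.sum_univ_four, Matrix.cons_val, H.self, H.symm 1 0, H.symm 2 0, H.symm 2 1,
    H.symm 3 0, H.symm 3 1, H.symm 3 2] at h0 h1 h2 h3
  linear_combination h0 + h1 - h2 - h3

theorem prod_eq (H : AreaSystem ![g, g, h, h] a e t)
    (hfac : h * (a 2 ^ 2 * (e 0 2 * e 1 2) + a 3 ^ 2 * (e 0 3 * e 1 3)) = g * e 0 1) :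
    g * ((1 - a 0 * a 2) * (1 - a 1 * a 2) * ((1 - a 0 * a 3) * (1 - a 1 * a 3))) =
      h * (1 - a 0 * a 1) * (a 2 ^ 2 * ((1 - a 0 * a 3) * (1 - a 1 * a 3)) +
        a 3 ^ 2 * ((1 - a 0 * a 2) * (1 - a 1 * a 2))) := by
  have h01 := H.mul_one_sub 0 1 (by decide)
  have h2 := H.mul_mul_one_sub (i := 0) (j := 2) (k := 1) (l := 2) (by decide) (by decide)
  have h3 := H.mul_mul_one_sub (i := 0) (j := 3) (k := 1) (l := 3) (by decide) (by decide)
  generalize (1 - a 0 * a 2) * (1 - a 1 * a 2) = d₂ at *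
  generalize (1 - a 0 * a 3) * (1 - a 1 * a 3) = d₃ at *
  linear_combination -((1 - a 0 * a 1) * d₂ * d₃) * hfac - g * (d₂ * d₃) * h01
    + h * (1 - a 0 * a 1) * (a 2 ^ 2 * d₃ * h2 + a 3 ^ 2 * d₂ * h3)

end Pairs

end AreaSystem

namespace AreaSystem

section Pairs

variable {S : Type*} [CommRing S] {g h t : S} {a : Fin 4 → S} {e : Fin 4 → Fin 4 → S}

theorem trapezoid_factor_of_cleared {m a b c d : S} (hsum : a + b + m * (c + d) = 0)
    (hcleared : (a + b) * (m * (c ^ 2 * ((1 - a * d) * (1 - b * d)) +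
        d ^ 2 * ((1 - a * c) * (1 - b * c))))
      + m * (c * ((1 - a * c) + (1 - b * c)) * ((1 - a * d) * (1 - b * d))
        + d * ((1 - a * d) + (1 - b * d)) * ((1 - a * c) * (1 - b * c)))
      = (c + d) * (a ^ 2 * ((1 - b * c) * (1 - b * d)) + b ^ 2 * ((1 - a * c) * (1 - a * d)))
      + (a * ((1 - a * c) + (1 - a * d)) * ((1 - b * c) * (1 - b * d))
        + b * ((1 - b * c) + (1 - b * d)) * ((1 - a * c) * (1 - a * d)))) :
    4 * ((c + d) * ((1 + m * (c * d)) * (m + a * b))) = 0 := by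
  obtain rfl : a = -b - m * (c + d) := by linear_combination hsum
  linear_combination hcleared

theorem trapezoid_factor {m : S} (H : AreaSystem ![1, 1, m, m] a e t)
    (hleft : m * (a 2 ^ 2 * (e 0 2 * e 1 2) + a 3 ^ 2 * (e 0 3 * e 1 3)) = 1 * e 0 1)
    (hright : 1 * (a 0 ^ 2 * (e 0 2 * e 0 3) + a 1 ^ 2 * (e 1 2 * e 1 3)) = m * e 2 3) :
    4 * ((a 2 + a 3) * ((1 + m * (a 2 * a 3)) * (m + a 0 * a 1))) = 0 := by
  refine trapezoid_factor_of_cleared (by linear_combination H.sum_mul_pairs) ?_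
  have h02 := H.mul_one_sub 0 2 (by decide)
  have h03 := H.mul_one_sub 0 3 (by decide)
  have h12 := H.mul_one_sub 1 2 (by decide)
  have h13 := H.mul_one_sub 1 3 (by decide)
  have hbal : (a 0 + a 1) * (m * (a 2 ^ 2 * (e 0 2 * e 1 2) + a 3 ^ 2 * (e 0 3 * e 1 3)))
      + m * (a 2 * (e 0 2 + e 1 2) + a 3 * (e 0 3 + e 1 3))
      = (a 2 + a 3) * (a 0 ^ 2 * (e 0 2 * e 0 3) + a 1 ^ 2 * (e 1 2 * e 1 3))
      + (a 0 * (e 0 2 + e 0 3) + a 1 * (e 1 2 + e 1 3)) := by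
    linear_combination H.balance_pairs + (a 0 + a 1) * hleft - (a 2 + a 3) * hright
  generalize 1 - a 0 * a 2 = d02 at *
  generalize 1 - a 0 * a 3 = d03 at *
  generalize 1 - a 1 * a 2 = d12 at *
  generalize 1 - a 1 * a 3 = d13 at *
  have h2 : e 0 2 * e 1 2 * (d02 * d12) = 1 := by linear_combination e 1 2 * d12 * h02 + h12
  have h3 : e 0 3 * e 1 3 * (d03 * d13) = 1 := by linear_combination e 1 3 * d13 * h03 + h13
  have h0 : e 0 2 * e 0 3 * (d02 * d03) = 1 := by linear_combination e 0 3 * d03 * h02 + h03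
  have h1 : e 1 2 * e 1 3 * (d12 * d13) = 1 := by linear_combination e 1 3 * d13 * h12 + h13
  linear_combination (d02 * d03 * d12 * d13) * hbal
    - (a 0 + a 1) * m * (a 2 ^ 2 * d03 * d13 * h2 + a 3 ^ 2 * d02 * d12 * h3)
    - m * (a 2 * d03 * d13 * (d12 * h02 + d02 * h12) + a 3 * d02 * d12 * (d13 * h03 + d03 * h13))
    + (a 2 + a 3) * (a 0 ^ 2 * d12 * d13 * h0 + a 1 ^ 2 * d02 * d03 * h1)
    + (a 0 * d12 * d13 * (d03 * h02 + d02 * h03) + a 1 * d02 * d03 * (d13 * h12 + d12 * h13))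

section Kite

variable (H : AreaSystem ![g, g, h, h] a e t) (h01 : a 0 = a 1)
  (hright : g * (a 0 ^ 2 * (e 0 2 * e 0 3) + a 1 ^ 2 * (e 1 2 * e 1 3)) = h * e 2 3)
include H h01 hright

theorem kite_mul_mul :
    h * ((1 - a 0 * a 2) * (1 - a 0 * a 3)) = 2 * g * a 0 ^ 2 * (1 - a 2 * a 3) := by
  have h02 := H.apply_eq_of_eq h01 (k := 2) (by decide) (by decide)
  have h03 := H.apply_eq_of_eq h01 (k := 3) (by decide) (by decide)
  rw [← h01, ← h02, ← h03] at hright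
  linear_combination -(1 - a 2 * a 3) * ((1 - a 0 * a 2) * (1 - a 0 * a 3)) * hright
    - h * ((1 - a 0 * a 2) * (1 - a 0 * a 3)) * H.mul_one_sub 2 3 (by decide)
    + 2 * g * a 0 ^ 2 * (1 - a 2 * a 3) *
      H.mul_mul_one_sub (i := 0) (j := 2) (k := 0) (l := 3) (by decide) (by decide)

theorem kite_mul : (h + 2 * g) * a 0 ^ 2 * (a 2 * a 3) = -h := by
  have hsum := H.sum_mul_pairs
  rw [← h01] at hsum
  linear_combination kite_mul_mul H h01 hright + a 0 * hsum

theorem kite_quadratic :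
    4 * a 0 * (g * (h + 2 * g) * (g + 2 * h) * (a 0 ^ 2) ^ 2
      - h * (h ^ 2 + 2 * g * h + 3 * g ^ 2) * a 0 ^ 2 + h ^ 3) = 0 := by
  have hbal := H.balance_pairs
  have hsum := H.sum_mul_pairs
  rw [← h01] at hsum
  rw [← h01, ← H.apply_eq_of_eq h01 (k := 2) (by decide) (by decide),
    ← H.apply_eq_of_eq h01 (k := 3) (by decide) (by decide)] at hbal
  have hcleared : 2 * (g * a 0 * (e 0 1 + e 2 3) * ((1 - a 0 * a 2) * (1 - a 0 * a 3))
      + h * (a 2 + a 3 - 2 * a 0 * (a 2 * a 3)) - g * a 0 * (2 - a 0 * (a 2 + a 3))) = 0 := by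
    linear_combination (1 - a 0 * a 2) * (1 - a 0 * a 3) * (hbal + e 2 3 * hsum)
      + 2 * ((g * a 0 - h * a 2) * (1 - a 0 * a 3) * H.mul_one_sub 0 2 (by decide)
        + (g * a 0 - h * a 3) * (1 - a 0 * a 2) * H.mul_one_sub 0 3 (by decide))
  have hreduced : 4 * a 0 * (g ^ 2 * a 0 ^ 2 * ((1 - a 2 * a 3) * e 0 1) - 2 * g * h
      - h ^ 2 * (a 2 * a 3)) = 0 := by
    linear_combination h * hcleared - 2 * g * a 0 * (e 0 1 + e 2 3) * kite_mul_mul H h01 hright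
      - 4 * g ^ 2 * a 0 ^ 3 * H.mul_one_sub 2 3 (by decide)
      - 2 * h * hsum - 2 * g * a 0 ^ 2 * hsum
  have hinv := H.mul_one_sub 0 1 (by decide)
  rw [← h01] at hinv
  linear_combination (1 - a 0 ^ 2) * a 0 ^ 2 * (h + 2 * g) * hreduced
    - 4 * a 0 * (a 0 ^ 2 * (h + 2 * g)) * (g ^ 2 * a 0 ^ 2 * (1 - a 2 * a 3)) * hinv
    + 4 * a 0 * (g ^ 2 * a 0 ^ 2 + h ^ 2 * (1 - a 0 ^ 2)) * kite_mul H h01 hright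

end Kite

end Pairs

end AreaSystem

namespace AreaSystem

section Rhombus

section Algebra

variable {S : Type*} [CommRing S] {m t : S} {a : Fin 4 → S} {e : Fin 4 → Fin 4 → S}
  (H : AreaSystem ![1, 1, m, m] a e t) (h01 : a 0 = a 1) (h23 : a 2 = a 3)
  (h02 : a 0 = -(m * a 2))
include H h01 h23 h02

theorem rhombus_balance : 2 * m * a 2 * (e 0 1 + e 2 3 - 4 * e 0 2) = 0 := by
  have hbal := H.balance_pairs
  have h03 : e 0 3 = e 0 2 := by
    rw [H.symm 0 3, H.symm 0 2, H.apply_eq_of_eq h23 (by decide) (by decide)]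
  rw [← h01, ← h23, ← H.apply_eq_of_eq h01 (k := 2) (by decide) (by decide),
    ← H.apply_eq_of_eq h01 (k := 3) (by decide) (by decide), h03, h02] at hbal
  linear_combination -hbal

theorem rhombus_quadratic (hE : e 0 1 + e 2 3 - 4 * e 0 2 = 0) :
    -(m + 4 * m ^ 2 + m ^ 3) * (a 2 ^ 2) ^ 2 + (3 + 2 * m + 3 * m ^ 2) * a 2 ^ 2 - 2 = 0 := by
  have i01 := H.mul_one_sub 0 1 (by decide)
  have i23 := H.mul_one_sub 2 3 (by decide)
  have i02 := H.mul_one_sub 0 2 (by decide)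
  rw [← h01, h02] at i01
  rw [← h23] at i23
  rw [h02] at i02
  linear_combination
    (1 - m ^ 2 * a 2 ^ 2) * (1 - a 2 ^ 2) * (1 + m * a 2 ^ 2) * hE
    - (1 - a 2 ^ 2) * (1 + m * a 2 ^ 2) * i01 - (1 - m ^ 2 * a 2 ^ 2) * (1 + m * a 2 ^ 2) * i23
    + 4 * (1 - m ^ 2 * a 2 ^ 2) * (1 - a 2 ^ 2) * i02

end Algebra

theorem rhombus_factor_lt {g h t : ℝ} {a : Fin 4 → ℝ} {e : Fin 4 → Fin 4 → ℝ} (hg : 0 < g)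
    (H : AreaSystem ![g, g, h, h] a e t) (h01 : a 0 = a 1) (h23 : a 2 = a 3)
    (hpos : 0 < 1 - a 0 * a 1) :
    h * (a 2 ^ 2 * (e 0 2 * e 1 2) + a 3 ^ 2 * (e 0 3 * e 1 3)) < g * e 0 1 := by
  have hsum := H.sum_mul_pairs
  have hinv := H.mul_one_sub 0 1 (by decide)
  have hcross := H.mul_one_sub 0 2 (by decide)
  have h03 : e 0 3 = e 0 2 := by
    rw [H.symm 0 3, H.symm 0 2, H.apply_eq_of_eq h23 (by decide) (by decide)]
  rw [← H.apply_eq_of_eq h01 (k := 2) (by decide) (by decide),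
    ← H.apply_eq_of_eq h01 (k := 3) (by decide) (by decide), h03, ← h23]
  rw [← h01, ← h23] at hsum
  rw [← h01] at hinv hpos
  have hone : 1 ≤ e 0 1 := by
    have : 0 < e 0 1 := pos_of_mul_pos_left (by rw [hinv]; exact one_pos) hpos.le
    nlinarith [mul_self_nonneg (a 0)]
  calc h * (a 2 ^ 2 * (e 0 2 * e 0 2) + a 2 ^ 2 * (e 0 2 * e 0 2))
      = g * (1 - (e 0 2 ^ 2 + (1 - e 0 2) ^ 2)) := by
        linear_combination a 2 * e 0 2 ^ 2 * hsum + 2 * g * e 0 2 * hcross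
    _ < g * 1 := by
        have : 0 < e 0 2 ^ 2 + (1 - e 0 2) ^ 2 := by nlinarith [sq_nonneg (2 * e 0 2 - 1)]
        nlinarith
    _ ≤ g * e 0 1 := by gcongr

variable {m : ℝ} {t : ℝ[ε]} {a : Fin 4 → ℝ[ε]} {e : Fin 4 → Fin 4 → ℝ[ε]}

theorem fst_pairs (H : AreaSystem ![1, 1, inl m, inl m] a e t) :
    AreaSystem ![1, 1, m, m] (fun i => (a i).fst) (fun i j => (e i j).fst) t.fst :=
  H.map_pairs (fstHom ℝ ℝ ℝ : ℝ[ε] →+* ℝ)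

theorem eq_and_eq_of_rhombus (hm0 : 0 < m) (H : AreaSystem ![1, 1, inl m, inl m] a e t)
    (hpos : ∀ i j, i ≠ j → 0 < 1 - (a i).fst * (a j).fst)
    (h01 : (a 0).fst = (a 1).fst) (h23 : (a 2).fst = (a 3).fst) : a 0 = a 1 ∧ a 2 = a 3 := by
  constructor
  · refine sub_eq_zero.1 (eq_zero_of_fst_ne_zero_of_mul_right ?_ H.sub_mul_eq_zero_left)
    have := rhombus_factor_lt one_pos H.fst_pairs h01 h23 (hpos 0 1 (by decide))
    simpa [fst_pow] using (sub_neg.2 this).ne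
  · refine sub_eq_zero.1 (eq_zero_of_fst_ne_zero_of_mul_right ?_ H.swap.sub_mul_eq_zero_left)
    have := rhombus_factor_lt hm0 H.fst_pairs.swap h23 h01 (hpos 2 3 (by decide))
    simpa [fst_pow] using (sub_neg.2 this).ne

theorem discrim_rhombus_pos (hm0 : 0 < m) :
    0 < discrim (-(m + 4 * m ^ 2 + m ^ 3)) (3 + 2 * m + 3 * m ^ 2) (-2) := by
  have : discrim (-(m + 4 * m ^ 2 + m ^ 3)) (3 + 2 * m + 3 * m ^ 2) (-2) =
      9 * (1 - m ^ 2) ^ 2 + 4 * m * (1 + m) ^ 2 := by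
    rw [discrim]; ring
  rw [this]
  positivity

theorem snd_eq_zero_of_rhombus (hm0 : 0 < m) (H : AreaSystem ![1, 1, inl m, inl m] a e t)
    (h01 : a 0 = a 1) (h23 : a 2 = a 3) (i : Fin 4) : (a i).snd = 0 := by
  have h0 : a 0 = -(inl m * a 2) := by
    have : 2 * (a 0 + inl m * a 2) = 0 := by
      linear_combination H.sum_mul_pairs + h01 + inl m * h23
    exact eq_neg_of_add_eq_zero_left
      (eq_zero_of_fst_ne_zero_of_mul_left (by simp [fst_ofNat]) this)
  suffices h : (a 2).snd = 0 by
    fin_cases i <;> simp [← h01, ← h23, h0, h]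
  have hbal := rhombus_balance H h01 h23 h0
  have h2m : (2 * inl m : ℝ[ε]).fst ≠ 0 := by simpa [fst_ofNat] using hm0.ne'
  by_cases hy : (a 2).fst = 0
  · have hone (i j : Fin 4) (hij : i ≠ j) (hi : (a i).fst = 0) : (e i j).fst = 1 := by
      simpa [hi] using congrArg fst (H.mul_one_sub i j hij)
    have hx : (a 0).fst = 0 := by simp [h0, hy]
    have hE : (e 0 1 + e 2 3 - 4 * e 0 2).fst ≠ 0 := by
      simp only [fst_sub, fst_add, fst_mul, fst_ofNat, hone 0 1 (by decide) hx,
        hone 2 3 (by decide) hy, hone 0 2 (by decide) hx]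
      norm_num
    rw [eq_zero_of_fst_ne_zero_of_mul_left h2m (eq_zero_of_fst_ne_zero_of_mul_right hE hbal),
      snd_zero]
  · refine snd_eq_zero_of_snd_mul_self hy
      (snd_eq_zero_of_quadratic (discrim_rhombus_pos hm0).ne' ?_)
    have hE := eq_zero_of_fst_ne_zero_of_mul_left (by rw [fst_mul]; exact mul_ne_zero h2m hy) hbal
    simp only [pow_succ, pow_zero, one_mul, inl_neg, inl_add, inl_mul, inl_ofNat]
    linear_combination rhombus_quadratic H h01 h23 h0 hE

end Rhombus

end AreaSystem

section KiteInequalities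

variable {m : ℝ}

theorem kite_cubic {x y z : ℝ} (hm0 : 0 < m) (hsum : x + x + m * (y + z) = 0)
    (hprod : (m + 2) * x ^ 2 * (y * z) = -m)
    (hcross : m * ((1 - x * y) * (1 - x * z)) = 2 * x ^ 2 * (1 - y * z))
    (hfac : (1 - x * y) * (1 - x * y) * ((1 - x * z) * (1 - x * z)) =
      m * (1 - x * x) * (y ^ 2 * ((1 - x * z) * (1 - x * z)) +
        z ^ 2 * ((1 - x * y) * (1 - x * y)))) :
    (m + 2) * x ^ 2 * ((m + 2) * x ^ 2 + m) ^ 2 = m * (m + 2 - (m + 2) * x ^ 2) *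
      (((m + 2) * x ^ 2 - m ^ 2) ^ 2 + m ^ 2 * ((m + 2) * x ^ 2 + m)) := by
  have hx : x ≠ 0 := by
    rintro rfl
    exact hm0.ne' (by linear_combination hprod)
  have hP : m * (m + 2) * ((1 - x * y) * (1 - x * z)) = 2 * ((m + 2) * x ^ 2 + m) := by
    linear_combination (m + 2) * hcross - 2 * hprod
  have hN : (m + 2) * x ^ 2 * (m * (y + z - 2 * x * (y * z))) =
      -2 * x * ((m + 2) * x ^ 2 - m ^ 2) := by
    linear_combination (m + 2) * x ^ 2 * hsum - 2 * x * m * hprod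
  have hsq : ((1 - x * y) * (1 - x * z)) ^ 2 = m * (1 - x ^ 2) *
      ((y + z - 2 * x * (y * z)) ^ 2 - 2 * (y * z) * ((1 - x * y) * (1 - x * z))) := by
    linear_combination hfac
  generalize (1 - x * y) * (1 - x * z) = P at *
  generalize y + z - 2 * x * (y * z) = N at *
  obtain ⟨C, hC⟩ : ∃ C, C = (m + 2) * x ^ 2 := ⟨_, rfl⟩
  have hscaled : (C * (m * (m + 2) * P)) ^ 2 = m * (m + 2) ^ 2 * (1 - x ^ 2) *
      ((C * (m * N)) ^ 2 - 2 * (C * (y * z)) * (C * (m * (m * P)))) := by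
    linear_combination (C * m * (m + 2)) ^ 2 * hsq
  rw [← hC] at hP hN hprod ⊢
  rw [hP, hN, hprod] at hscaled
  have h4C : 4 * C ≠ 0 := by rw [hC]; positivity
  refine mul_left_cancel₀ h4C ?_
  linear_combination hscaled + 2 * m ^ 3 * (m + 2) * (1 - x ^ 2) * C * hP
    - 4 * m * (m + 2) * (1 - x ^ 2) * (C - m ^ 2) ^ 2 * hC
    + 4 * C * m * ((C - m ^ 2) ^ 2 + m ^ 2 * (C + m)) * hC

theorem kite_cubic_ne {C : ℝ} (hm0 : 0 < m) (hm1 : m < 1) (hC0 : 0 < C) (hC : C < m + 2)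
    (hquad : C * (C + m) = m * (m + 2 - C) * (2 * C - m ^ 2)) :
    C * (C + m) ^ 2 ≠ m * (m + 2 - C) * ((C - m ^ 2) ^ 2 + m ^ 2 * (C + m)) := by
  intro hcubic
  have hC' : 0 < m + 2 - C := by linarith
  have hdiff : (2 * C - m ^ 2) * (C + m) = (C - m ^ 2) ^ 2 + m ^ 2 * (C + m) :=
    mul_left_cancel₀ (mul_pos hm0 hC').ne' (by linear_combination hcubic - (C + m) * hquad)
  have hval : C = m * (m + 1) / 2 :=
    mul_left_cancel₀ (mul_pos (by positivity : 0 < 2 * (m + 1)) hC0).ne'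
      (by linear_combination hdiff + hquad)
  have hzero : m ^ 2 * ((1 - m) * (3 * m + 5)) = 0 := by
    rw [hval] at hdiff
    linear_combination 4 * hdiff
  have : 0 < 1 - m := by linarith
  exact (by positivity : 0 < m ^ 2 * ((1 - m) * (3 * m + 5))).ne' hzero

theorem discrim_kite_pos (hm0 : 0 < m) (hm1 : m < 1) :
    0 < discrim ((m + 2) * (1 + 2 * m)) (-(m * (m ^ 2 + 2 * m + 3))) (m ^ 3) := by
  have : discrim ((m + 2) * (1 + 2 * m)) (-(m * (m ^ 2 + 2 * m + 3))) (m ^ 3) =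
      m ^ 2 * ((1 - m) * (1 + m) * (9 + 4 * m - m ^ 2)) := by
    rw [discrim]; ring
  rw [this]
  have : 0 < 1 - m := by linarith
  have : 0 < 9 + 4 * m - m ^ 2 := by nlinarith
  positivity

theorem kite_quadratic_pos {X : ℝ} (hm0 : 0 < m) (hm1 : m < 1) (hX0 : 0 < X) (hX1 : X < 1) :
    0 < m * (1 + 2 * m) * (m + 2) * X ^ 2 - (1 + 2 * m + 3 * m ^ 2) * X + 1 := by
  have e : m * (1 + 2 * m) * (m + 2) * X ^ 2 - (1 + 2 * m + 3 * m ^ 2) * X + 1 =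
    (1 - X) ^ 2 + (1 - 3 * m) * (1 + m) * (X * (1 - X)) + 2 * m ^ 2 * (1 + m) * X ^ 2 := by ring
  rw [e]
  have : 0 < 1 - X := by linarith
  rcases le_total m (1 / 3) with h | h
  · have : 0 ≤ 1 - 3 * m := by linarith
    positivity
  · have : 0 < (1 - m) * (9 * m ^ 2 + 4 * m - 1) := mul_pos (by linarith) (by nlinarith)
    have hX2 : 0 < (1 + m) * ((1 - m) * (9 * m ^ 2 + 4 * m - 1)) * X ^ 2 := by positivity
    nlinarith [sq_nonneg (2 * (1 - X) + (1 - 3 * m) * (1 + m) * X), hX2]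

end KiteInequalities

namespace AreaSystem

section Kite

variable {m : ℝ} {t : ℝ[ε]} {a : Fin 4 → ℝ[ε]} {e : Fin 4 → Fin 4 → ℝ[ε]}

theorem ne_of_ne {t : ℝ} {a : Fin 4 → ℝ} {e : Fin 4 → Fin 4 → ℝ} (hm0 : 0 < m) (hm1 : m < 1)
    (H : AreaSystem ![1, 1, m, m] a e t) (hpos : 0 < 1 - a 2 * a 3) (h01 : a 0 ≠ a 1) :
    a 2 ≠ a 3 := by
  intro h23
  have hleft := (mul_eq_zero.1 H.sub_mul_eq_zero_left).resolve_left (sub_ne_zero.2 h01)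
  rw [sub_eq_zero, ← H.symm 2 0, ← H.symm 2 1, ← H.symm 3 0, ← H.symm 3 1] at hleft
  have hx : a 2 ≠ 0 := by
    intro h0
    have hprod : (1 + 2 * m) * a 2 ^ 2 * (a 0 * a 1) = -1 := kite_mul H.swap h23 hleft
    simp [h0] at hprod
  have hquad : 4 * a 2 * (m * (1 + 2 * m) * (m + 2 * 1) * (a 2 ^ 2) ^ 2
      - 1 * (1 ^ 2 + 2 * m * 1 + 3 * m ^ 2) * a 2 ^ 2 + 1 ^ 3) = 0 :=
    kite_quadratic H.swap h23 hleft
  rw [← h23] at hpos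
  refine (kite_quadratic_pos hm0 hm1 (X := a 2 ^ 2) (by positivity) (by linarith)).ne' ?_
  linear_combination (mul_eq_zero.1 hquad).resolve_left (by simpa using hx)

theorem ne_zero_and_ne_of_kite {t : ℝ} {a : Fin 4 → ℝ} {e : Fin 4 → Fin 4 → ℝ} (hm0 : 0 < m)
    (hm1 : m < 1) (H : AreaSystem ![1, 1, m, m] a e t) (hpos : 0 < 1 - a 0 * a 1)
    (h01 : a 0 = a 1)
    (hright : 1 * (a 0 ^ 2 * (e 0 2 * e 0 3) + a 1 ^ 2 * (e 1 2 * e 1 3)) = m * e 2 3) :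
    a 0 ≠ 0 ∧
      m * (a 2 ^ 2 * (e 0 2 * e 1 2) + a 3 ^ 2 * (e 0 3 * e 1 3)) ≠ 1 * e 0 1 := by
  have hprod := kite_mul H h01 hright
  have hcross := kite_mul_mul H h01 hright
  have hx : a 0 ≠ 0 := by
    intro h0
    exact hm0.ne' (by simpa [h0] using hprod)
  refine ⟨hx, fun hleft => ?_⟩
  have hfac := H.prod_eq hleft
  have hsum := H.sum_mul_pairs
  rw [← h01] at hfac hsum hpos
  have hquad := (mul_eq_zero.1 (kite_quadratic H h01 hright)).resolve_left (by simpa using hx)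
  refine kite_cubic_ne hm0 hm1 (C := (m + 2) * a 0 ^ 2) (by positivity) (by nlinarith)
    (by linear_combination (m + 2) * hquad)
    (kite_cubic (x := a 0) (y := a 2) (z := a 3) hm0
      (by linear_combination hsum) (by linear_combination hprod)
      (by linear_combination hcross) (by linear_combination hfac))

theorem snd_eq_zero_of_kite (hm0 : 0 < m) (hm1 : m < 1)
    (H : AreaSystem ![1, 1, inl m, inl m] a e t)
    (hpos : 0 < 1 - (a 0).fst * (a 1).fst) (h01 : (a 0).fst = (a 1).fst)
    (h23 : (a 2).fst ≠ (a 3).fst) (i : Fin 4) : (a i).snd = 0 := by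
  have hright := sub_eq_zero.1 (eq_zero_of_fst_ne_zero_of_mul_left
    (by simpa [sub_eq_zero] using h23) H.sub_mul_eq_zero_right)
  obtain ⟨hx, hleft⟩ := ne_zero_and_ne_of_kite hm0 hm1 H.fst_pairs hpos h01
    (by simpa [fst_pow] using congrArg fst hright)
  have h01' : a 0 = a 1 := by
    refine sub_eq_zero.1 (eq_zero_of_fst_ne_zero_of_mul_right ?_ H.sub_mul_eq_zero_left)
    simpa [fst_pow, sub_eq_zero] using hleft
  have hX : (a 0 * a 0).snd = 0 := by
    refine snd_eq_zero_of_quadratic (discrim_kite_pos hm0 hm1).ne' ?_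
    have hquad := eq_zero_of_fst_ne_zero_of_mul_left (by simpa [fst_ofNat] using hx)
      (kite_quadratic H h01' hright)
    simp only [pow_succ, pow_zero, one_mul, inl_neg, inl_add, inl_mul, inl_ofNat, inl_one]
    linear_combination hquad
  have h0 := snd_eq_zero_of_snd_mul_self hx hX
  have hsum : (a 2 + a 3).snd = 0 := by
    have := congrArg snd H.sum_mul_pairs
    simpa [DualNumber.snd_mul, ← h01', h0, hm0.ne'] using this
  have hprod : (a 2 * a 3).snd = 0 := by
    have := congrArg snd (kite_mul H h01' hright)
    rw [sq, DualNumber.snd_mul _ (a 2 * a 3), DualNumber.snd_mul _ (a 0 * a 0), hX] at this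
    have hm2 : m + 2 ≠ 0 := by positivity
    simpa [fst_ofNat, snd_ofNat, hx, hm2] using this
  obtain ⟨h2, h3⟩ := snd_eq_zero_of_snd_add_of_snd_mul h23 hsum hprod
  fin_cases i <;> simp [← h01', h0, h2, h3]

end Kite

end AreaSystem

/-- What remains of the area system with circulations `1, 1, m, m` and areas `a, b, c, d` when
`a ≠ b` and `c ≠ d`, after clearing denominators. -/
structure ScaleneSystem {S : Type*} [CommRing S] (m a b c d : S) : Prop where
  sum_eq : a + b + m * (c + d) = 0
  left : (1 - a * c) * (1 - b * c) * ((1 - a * d) * (1 - b * d)) =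
    m * (1 - a * b) * (c ^ 2 * ((1 - a * d) * (1 - b * d)) + d ^ 2 * ((1 - a * c) * (1 - b * c)))
  right : m * ((1 - a * c) * (1 - a * d) * ((1 - b * c) * (1 - b * d))) =
    (1 - c * d) * (a ^ 2 * ((1 - b * c) * (1 - b * d)) + b ^ 2 * ((1 - a * c) * (1 - a * d)))
  factor : (c + d) * ((1 + m * (c * d)) * (m + a * b)) = 0

namespace ScaleneSystem

section Algebra

variable {S T : Type*} [CommRing S] [CommRing T] {m a b c d : S}

theorem map (f : S →+* T) (H : ScaleneSystem m a b c d) :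
    ScaleneSystem (f m) (f a) (f b) (f c) (f d) where
  sum_eq := by simpa using congrArg f H.sum_eq
  left := by simpa using congrArg f H.left
  right := by simpa using congrArg f H.right
  factor := by simpa using congrArg f H.factor

theorem trapezoid_eqs (H : ScaleneSystem m a (-a) c (-c)) (hu : IsUnit (1 - a * a * (c * c))) :
    1 - a * a * (c * c) = 2 * m * (c * c) * (1 + a * a) ∧
      m * (1 - a * a * (c * c)) = 2 * (a * a) * (1 + c * c) :=
  ⟨hu.mul_left_cancel (by linear_combination H.left),
    hu.mul_left_cancel (by linear_combination H.right)⟩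

theorem asymmetric_eqs (H : ScaleneSystem m a b c d) (hab : m + a * b = 0) (hm : IsUnit m)
    (hu : IsUnit (1 + m * (c * d))) :
    1 + m * (c * d) = 2 * (1 - c * d) ∧
      1 + m * (c * d) = m * (1 + m) * ((c + d) * (c + d) - 2 * (c * d)) := by
  have hc : (1 - a * c) * (1 - b * c) = 1 + m * (c * d) := by
    linear_combination -c * H.sum_eq + c ^ 2 * hab
  have hd : (1 - a * d) * (1 - b * d) = 1 + m * (c * d) := by
    linear_combination -d * H.sum_eq + d ^ 2 * hab
  have hmix : a ^ 2 * ((1 - b * c) * (1 - b * d)) + b ^ 2 * ((1 - a * c) * (1 - a * d)) =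
      2 * m * (1 + m * (c * d)) := by
    linear_combination (a + b) * H.sum_eq
      + (-2 - (c + d) * (a + b) + 2 * (c * d) * (a * b - m)) * hab
  have hleft := H.left
  have hright : m * ((1 - a * c) * (1 - b * c) * ((1 - a * d) * (1 - b * d))) =
      (1 - c * d) *
        (a ^ 2 * ((1 - b * c) * (1 - b * d)) + b ^ 2 * ((1 - a * c) * (1 - a * d))) := by
    linear_combination H.right
  rw [hc, hd] at hleft hright
  rw [hmix] at hright
  exact ⟨hu.mul_left_cancel (hm.mul_left_cancel (by linear_combination hright)),
    hu.mul_left_cancel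
      (by linear_combination hleft - m * (1 + m * (c * d)) * (c ^ 2 + d ^ 2) * hab)⟩

end Algebra

section Real

variable {m a b c d : ℝ}

theorem trapezoid_factor_ne_zero (hm0 : 0 < m) (H : ScaleneSystem m a (-a) c (-c)) (ha : a ≠ 0)
    (hc : c ≠ 0) (hu : 1 - a * a * (c * c) ≠ 0) : (1 + m * (c * -c)) * (m + a * -a) ≠ 0 := by
  obtain ⟨h1, h2⟩ := H.trapezoid_eqs hu.isUnit
  have hA : 0 < a * a := mul_self_pos.2 ha
  have hC : 0 < c * c := mul_self_pos.2 hc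
  refine mul_ne_zero (fun h => ?_) fun h => ?_
  · have : m * (c * c) = 1 := by linear_combination -h
    nlinarith [mul_pos hA hC]
  · have haa : a * a = m := by linear_combination -h
    rw [haa] at h2
    nlinarith [mul_pos hm0 hC, mul_pos hm0 (mul_pos hm0 hC)]

theorem one_add_mul_ne_zero (hm0 : 0 < m) (hm1 : m < 1) (H : ScaleneSystem m a b c d)
    (hac : 0 < 1 - a * c) (had : 0 < 1 - a * d) : 1 + m * (c * d) ≠ 0 := by
  intro hcd
  have ha : m * ((1 - a * c) * (1 - a * d)) = m + a * b := by
    linear_combination -a * H.sum_eq + a ^ 2 * hcd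
  have hb : m * ((1 - b * c) * (1 - b * d)) = m + a * b := by
    linear_combination -b * H.sum_eq + b ^ 2 * hcd
  have hmix : m ^ 2 * (c ^ 2 * ((1 - a * d) * (1 - b * d)) + d ^ 2 * ((1 - a * c) * (1 - b * c))) =
      2 * (m + a * b) := by
    linear_combination m * (c + d) * H.sum_eq
      + (-2 * m - m * (c + d) * (a + b) + 2 * (a * b) * (m * (c * d) - 1)) * hcd
  have hpos : 0 < m + a * b := by rw [← ha]; positivity
  have hleft : m + a * b = 2 * m * (1 - a * b) := by
    refine mul_left_cancel₀ hpos.ne' ?_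
    have h := H.left
    have : (m * ((1 - a * c) * (1 - a * d))) * (m * ((1 - b * c) * (1 - b * d))) =
        m * (1 - a * b) * (m ^ 2 *
          (c ^ 2 * ((1 - a * d) * (1 - b * d)) + d ^ 2 * ((1 - a * c) * (1 - b * c)))) := by
      linear_combination m ^ 2 * h
    rw [ha, hb, hmix] at this
    linear_combination this
  have hright : m * (m + a * b) = (m + 1) * (a ^ 2 + b ^ 2) := by
    refine mul_left_cancel₀ hpos.ne' ?_
    have : m * ((m * ((1 - a * c) * (1 - a * d))) * (m * ((1 - b * c) * (1 - b * d)))) =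
        m * (1 - c * d) * (a ^ 2 * (m * ((1 - b * c) * (1 - b * d))) +
          b ^ 2 * (m * ((1 - a * c) * (1 - a * d)))) := by
      linear_combination m ^ 2 * H.right
    rw [ha, hb] at this
    linear_combination this - (m + a * b) * (a ^ 2 + b ^ 2) * hcd
  have hsq : (m + 1) * (1 + 2 * m) * (a - b) ^ 2 = -(2 * (m * (1 - m) * (1 + m))) := by
    linear_combination -(1 + 2 * m) * hright + (m - 2 * (m + 1)) * hleft
  have : 0 ≤ (m + 1) * (1 + 2 * m) * (a - b) ^ 2 := by positivity
  have : 0 < m * (1 - m) * (1 + m) := mul_pos (mul_pos hm0 (by linarith)) (by linarith)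
  linarith

end Real

section Dual

variable {m : ℝ} {a b c d : ℝ[ε]}

theorem fst (H : ScaleneSystem (inl m) a b c d) : ScaleneSystem m a.fst b.fst c.fst d.fst :=
  H.map (fstHom ℝ ℝ ℝ : ℝ[ε] →+* ℝ)

theorem snd_eq_zero_of_trapezoid (hm0 : 0 < m) (H : ScaleneSystem (inl m) a (-a) c (-c))
    (ha : a.fst ≠ 0) (hc : c.fst ≠ 0) (hu : (1 - a * a * (c * c)).fst ≠ 0) :
    a.snd = 0 ∧ c.snd = 0 := by
  obtain ⟨h1, h2⟩ := H.trapezoid_eqs (isUnit_of_fst_ne_zero hu)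
  have hA : 0 < (a * a).fst := by rw [fst_mul]; exact mul_self_pos.2 ha
  have hC : 0 < (c * c).fst := by rw [fst_mul]; exact mul_self_pos.2 hc
  suffices h : (a * a).snd = 0 ∧ (c * c).snd = 0 from
    ⟨snd_eq_zero_of_snd_mul_self ha h.1, snd_eq_zero_of_snd_mul_self hc h.2⟩
  generalize a * a = A at *
  generalize c * c = C at *
  replace h1 := congrArg snd h1
  replace h2 := congrArg snd h2
  simp only [snd_sub, snd_add, DualNumber.snd_mul, fst_sub, fst_add, fst_mul, fst_inl, snd_inl,
    fst_one, snd_one, fst_ofNat, snd_ofNat] at h1 h2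
  have hD : 0 < 2 * A.fst * (1 + 2 * m) + 2 * m * (C.fst * (m + 2) + 2) := by positivity
  constructor
  · refine (mul_eq_zero.1 ?_).resolve_left hD.ne'
    linear_combination (A.fst * (m + 2)) * h1 - (A.fst * (1 + 2 * m) + 2 * m) * h2
  · refine (mul_eq_zero.1 ?_).resolve_left hD.ne'
    linear_combination (C.fst * (1 + 2 * m)) * h2 - (C.fst * (m + 2) + 2) * h1

end Dual

end ScaleneSystem

namespace ScaleneSystem

variable {m : ℝ} {a b c d : ℝ[ε]}

theorem snd_eq_zero_of_asymmetric (hm0 : 0 < m) (H : ScaleneSystem (inl m) a b c d)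
    (hab : inl m + a * b = 0) (hu : (1 + inl m * (c * d)).fst ≠ 0) (hne : a.fst ≠ b.fst)
    (hne' : c.fst ≠ d.fst) (hcd : c.fst + d.fst ≠ 0) :
    a.snd = 0 ∧ b.snd = 0 ∧ c.snd = 0 ∧ d.snd = 0 := by
  obtain ⟨hq, hp⟩ := H.asymmetric_eqs hab
    (isUnit_of_fst_ne_zero (by rw [fst_inl]; exact hm0.ne')) (isUnit_of_fst_ne_zero hu)
  have hprod : (c * d).snd = 0 := by
    replace hq := congrArg snd hq
    generalize c * d = q at hq ⊢
    simp only [snd_sub, snd_add, DualNumber.snd_mul, fst_sub, fst_inl, snd_inl, snd_one,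
      fst_ofNat, snd_ofNat] at hq
    have : (m + 2) * q.snd = 0 := by linear_combination hq
    exact (mul_eq_zero.1 this).resolve_left (by positivity)
  have hsum : (c + d).snd = 0 := by
    refine snd_eq_zero_of_snd_mul_self (by rwa [fst_add]) ?_
    replace hp := congrArg snd hp
    generalize c * d = q at hp hprod
    generalize (c + d) * (c + d) = p at hp ⊢
    simp only [snd_sub, snd_add, DualNumber.snd_mul, fst_sub, fst_add, fst_mul, fst_inl, snd_inl,
      fst_one, snd_one, fst_ofNat, snd_ofNat, hprod] at hp
    have : m * (1 + m) * p.snd = 0 := by linear_combination -hp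
    exact (mul_eq_zero.1 this).resolve_left (by positivity)
  have hsum' : (a + b).snd = 0 := by
    rw [eq_neg_of_add_eq_zero_left H.sum_eq, snd_neg, DualNumber.snd_mul, hsum, snd_inl]
    ring
  have hprod' : (a * b).snd = 0 := by
    rw [eq_neg_of_add_eq_zero_right hab, snd_neg, snd_inl, neg_zero]
  obtain ⟨ha, hb⟩ := snd_eq_zero_of_snd_add_of_snd_mul hne hsum' hprod'
  obtain ⟨hc, hd⟩ := snd_eq_zero_of_snd_add_of_snd_mul hne' hsum hprod
  exact ⟨ha, hb, hc, hd⟩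

theorem eq_neg_and_eq_neg (hm0 : 0 < m) (H : ScaleneSystem (inl m) a b c d)
    (hac : 0 < 1 - a.fst * c.fst) (had : 0 < 1 - a.fst * d.fst) (hne : a.fst ≠ b.fst)
    (hne' : c.fst ≠ d.fst) (hcd : c.fst + d.fst = 0) :
    b = -a ∧ d = -c ∧ a.fst ≠ 0 ∧ c.fst ≠ 0 ∧ (1 - a * a * (c * c)).fst ≠ 0 := by
  have hb : b.fst = -a.fst := by linear_combination H.fst.sum_eq - m * hcd
  have hd : d.fst = -c.fst := eq_neg_of_add_eq_zero_right hcd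
  have ha0 : a.fst ≠ 0 := fun h => hne (by rw [hb, h, neg_zero])
  have hc0 : c.fst ≠ 0 := fun h => hne' (by rw [hd, h, neg_zero])
  have hu : 1 - a.fst * a.fst * (c.fst * c.fst) ≠ 0 := by
    rw [hd] at had
    have := (mul_pos hac had).ne'
    contrapose! this
    linear_combination this
  have hfst := H.fst
  rw [hb, hd] at hfst
  have hcd' : c + d = 0 := by
    refine eq_zero_of_fst_ne_zero_of_mul_right ?_ H.factor
    simpa [hb, hd] using hfst.trapezoid_factor_ne_zero hm0 ha0 hc0 hu
  refine ⟨?_, eq_neg_of_add_eq_zero_right hcd', ha0, hc0, by simpa using hu⟩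
  linear_combination H.sum_eq - inl m * hcd'

theorem snd_eq_zero (hm0 : 0 < m) (hm1 : m < 1) (H : ScaleneSystem (inl m) a b c d)
    (hac : 0 < 1 - a.fst * c.fst) (had : 0 < 1 - a.fst * d.fst) (hne : a.fst ≠ b.fst)
    (hne' : c.fst ≠ d.fst) : a.snd = 0 ∧ b.snd = 0 ∧ c.snd = 0 ∧ d.snd = 0 := by
  by_cases hcd : c.fst + d.fst = 0
  · obtain ⟨rfl, rfl, ha, hc, hu⟩ := H.eq_neg_and_eq_neg hm0 hac had hne hne' hcd
    obtain ⟨ha', hc'⟩ := H.snd_eq_zero_of_trapezoid hm0 ha hc hu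
    simp [ha', hc']
  · have hu : (1 + inl m * (c * d)).fst ≠ 0 := by
      simpa using H.fst.one_add_mul_ne_zero hm0 hm1 hac had
    have hab := eq_zero_of_fst_ne_zero_of_mul_left hu
      (eq_zero_of_fst_ne_zero_of_mul_left (by rwa [fst_add]) H.factor)
    exact H.snd_eq_zero_of_asymmetric hm0 hab hu hne hne' hcd

end ScaleneSystem

namespace AreaSystem

variable {m : ℝ} {t : ℝ[ε]} {a : Fin 4 → ℝ[ε]} {e : Fin 4 → Fin 4 → ℝ[ε]}

theorem scaleneSystem (H : AreaSystem ![1, 1, inl m, inl m] a e t)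
    (h01 : (a 0).fst ≠ (a 1).fst) (h23 : (a 2).fst ≠ (a 3).fst) :
    ScaleneSystem (inl m) (a 0) (a 1) (a 2) (a 3) := by
  have hleft := sub_eq_zero.1 (eq_zero_of_fst_ne_zero_of_mul_left
    (by simpa [sub_eq_zero] using h01) H.sub_mul_eq_zero_left)
  have hright := sub_eq_zero.1 (eq_zero_of_fst_ne_zero_of_mul_left
    (by simpa [sub_eq_zero] using h23) H.sub_mul_eq_zero_right)
  have hright' := hright
  rw [H.symm 0 2, H.symm 0 3, H.symm 1 2, H.symm 1 3] at hright'
  have hR := H.swap.prod_eq hright'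
  simp only [Fin.isValue, Fin.reduceAdd] at hR
  exact
    { sum_eq := by linear_combination H.sum_mul_pairs
      left := by linear_combination H.prod_eq hleft
      right := by linear_combination hR
      factor := eq_zero_of_fst_ne_zero_of_mul_left (by simp [fst_ofNat])
        (H.trapezoid_factor hleft hright) }

theorem snd_eq_zero (hm0 : 0 < m) (hm1 : m < 1) (H : AreaSystem ![1, 1, inl m, inl m] a e t)
    (hpos : ∀ i j, i ≠ j → 0 < 1 - (a i).fst * (a j).fst) (i : Fin 4) : (a i).snd = 0 := by
  by_cases h01 : (a 0).fst = (a 1).fst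
  · by_cases h23 : (a 2).fst = (a 3).fst
    · obtain ⟨h01', h23'⟩ := eq_and_eq_of_rhombus hm0 H hpos h01 h23
      exact snd_eq_zero_of_rhombus hm0 H h01' h23' i
    · exact snd_eq_zero_of_kite hm0 hm1 H (hpos 0 1 (by decide)) h01 h23 i
  · have h23 : (a 2).fst ≠ (a 3).fst :=
      ne_of_ne hm0 hm1 H.fst_pairs (hpos 2 3 (by decide)) h01
    obtain ⟨h0, h1, h2, h3⟩ := (H.scaleneSystem h01 h23).snd_eq_zero hm0 hm1
      (hpos 0 2 (by decide)) (hpos 0 3 (by decide)) h01 h23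
    fin_cases i <;> assumption

end AreaSystem

/-! ### Affine relations and signed areas -/

/-- The `A i` are the coefficients of an affine relation between the points `(X i, Y i)`. -/
structure AffineRelation {ι S : Type*} [Fintype ι] [CommRing S] (A X Y : ι → S) : Prop where
  sum_eq_zero : ∑ i, A i = 0
  sum_mul_fst : ∑ i, A i * X i = 0
  sum_mul_snd : ∑ i, A i * Y i = 0

section AffineRelation

variable {ι S : Type*} [Fintype ι] [CommRing S] {A g a X Y : ι → S} {C : ι → ι → S}
  {κ ν r : S}

theorem AffineRelation.sum_mul_sqDist (hA : AffineRelation A X Y) (i : ι) :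
    ∑ j, A j * sqDist X Y i j = ∑ j, A j * (X j ^ 2 + Y j ^ 2) := by
  have h : ∑ j, A j * sqDist X Y i j = (X i ^ 2 + Y i ^ 2) * ∑ j, A j
      - 2 * X i * ∑ j, A j * X j - 2 * Y i * ∑ j, A j * Y j + ∑ j, A j * (X j ^ 2 + Y j ^ 2) := by
    simp only [Finset.mul_sum, ← Finset.sum_sub_distrib, ← Finset.sum_add_distrib]
    exact Finset.sum_congr rfl fun j _ => by rw [sqDist]; ring
  rw [h, hA.sum_eq_zero, hA.sum_mul_fst, hA.sum_mul_snd]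
  ring

theorem AffineRelation.sum_sum_mul_one_sub (hA : AffineRelation A X Y) (ν : S) :
    ∑ i, ∑ j, A i * A j * (1 - ν * sqDist X Y i j) = 0 := by
  have hrow (i : ι) : ∑ j, A i * A j * (1 - ν * sqDist X Y i j) =
      A i * ∑ j, A j - ν * A i * ∑ j, A j * sqDist X Y i j := by
    simp only [Finset.mul_sum, ← Finset.sum_sub_distrib]
    exact Finset.sum_congr rfl fun j _ => by ring
  simp only [hrow, hA.sum_eq_zero, hA.sum_mul_sqDist, mul_zero, zero_sub]
  rw [Finset.sum_neg_distrib, ← Finset.sum_mul, ← Finset.mul_sum, hA.sum_eq_zero]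
  ring

theorem affineRelation_of_force_eq_zero [DecidableEq ι] {i : ι} (hX : force C X i = 0)
    (hY : force C Y i = 0) :
    AffineRelation (fun j => C i j - if i = j then ∑ k, C i k else 0) X Y := by
  have hrow (Z : ι → S) :
      ∑ j, (C i j - if i = j then ∑ k, C i k else 0) * Z j = -force C Z i := by
    simp only [force, sub_mul, ite_mul, zero_mul, Finset.sum_sub_distrib, Finset.sum_ite_eq,
      Finset.mem_univ, if_true, mul_sub, Finset.sum_mul]
    ring
  exact ⟨by simp, by rw [hrow, hX, neg_zero], by rw [hrow, hY, neg_zero]⟩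

theorem Equilibrium.areaSystem (E : Equilibrium g X Y C ν) (hA : AffineRelation A X Y)
    (hκ : ∀ i j, i ≠ j → C i j = κ * (A i * A j)) (hr : ν * (r * r) = -κ)
    (hg : ∀ i, IsUnit (g i)) (ha : ∀ i, g i * a i = r * A i) :
    AreaSystem g a (fun i j => ν * sqDist X Y i j) (ν * (r * ∑ j, A j * (X j ^ 2 + Y j ^ 2))) where
  sum_mul := by simp only [ha, ← Finset.mul_sum, hA.sum_eq_zero, mul_zero]
  symm i j := by rw [sqDist_comm]
  self i := by rw [sqDist_self, mul_zero]
  mul_one_sub i j hij := by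
    refine ((hg i).mul (hg j)).mul_left_cancel ?_
    have hC := E.coupling_mul_sqDist i j hij
    rw [hκ i j hij] at hC
    linear_combination -(ν * sqDist X Y i j) * (g j * a j * ha i + r * A i * ha j)
      - sqDist X Y i j * (A i * A j) * hr + hC
  balance i := by
    rw [← hA.sum_mul_sqDist i, Finset.mul_sum, Finset.mul_sum]
    refine Finset.sum_congr rfl fun j _ => ?_
    linear_combination ν * sqDist X Y i j * ha j

end AffineRelation

section Dziobek

variable {ι : Type*} [Fintype ι] {γ x y A : ι → ℝ} {C : ι → ι → ℝ} {κ ν : ℝ}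

theorem AffineRelation.eq_zero_of_sqDist_eq (hA : AffineRelation A x y)
    (h : ∀ i j, i ≠ j → ν * sqDist x y i j = 1) (i : ι) : A i = 0 := by
  classical
  have hneg (j : ι) : ν * ∑ k, A k * (x k ^ 2 + y k ^ 2) = -A j := by
    have hterm (k : ι) :
        ν * (A k * sqDist x y j k) = A k - if j = k then A k else 0 := by
      by_cases hjk : j = k
      · simp [← hjk, sqDist_self]
      · rw [if_neg hjk]
        linear_combination A k * h j k hjk
    rw [← hA.sum_mul_sqDist j, Finset.mul_sum, Finset.sum_congr rfl fun k _ => hterm k,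
      Finset.sum_sub_distrib, hA.sum_eq_zero, Finset.sum_ite_eq, if_pos (Finset.mem_univ j),
      zero_sub]
  have hconst (j : ι) : A j = A i := by linear_combination hneg j - hneg i
  have hcard := hA.sum_eq_zero
  rw [Finset.sum_congr rfl fun j _ => hconst j, Finset.sum_const, smul_eq_zero] at hcard
  exact hcard.resolve_left (Finset.card_pos.2 ⟨i, Finset.mem_univ i⟩).ne'

/-- Summing `C i j * (1 - ν * sqDist x y i j)` over the pairs `i ≠ j` gives `-κ * ∑ i, A i ^ 2`,
and every term is nonnegative. -/
theorem Equilibrium.dziobek_neg (E : Equilibrium γ x y C ν) (hA : AffineRelation A x y)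
    (hγ : ∀ i, 0 < γ i) (hs : ∀ i j, i ≠ j → 0 < sqDist x y i j)
    (hκ : ∀ i j, i ≠ j → C i j = κ * (A i * A j)) {k : ι} (hk : A k ≠ 0) : κ < 0 := by
  classical
  have hterm (i j : ι) :
      0 ≤ κ * (A i * A j * (1 - ν * sqDist x y i j)) - if i = j then κ * A i ^ 2 else 0 := by
    by_cases hij : i = j
    · exact le_of_eq (by simp only [hij, sqDist_self, if_true]; ring)
    · rw [if_neg hij, sub_zero, ← mul_assoc, ← hκ i j hij]
      refine nonneg_of_mul_nonneg_left ?_ (hs i j hij)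
      have hγγ := mul_pos (hγ i) (hγ j)
      calc 0 ≤ γ i * γ j * (1 - ν * sqDist x y i j) ^ 2 := by positivity
        _ = C i j * (1 - ν * sqDist x y i j) * sqDist x y i j := by
          linear_combination -(1 - ν * sqDist x y i j) * E.coupling_mul_sqDist i j hij
  have hsum : ∑ i, ∑ j, (κ * (A i * A j * (1 - ν * sqDist x y i j))
      - if i = j then κ * A i ^ 2 else 0) = -(κ * ∑ i, A i ^ 2) := by
    simp only [Finset.sum_sub_distrib, ← Finset.mul_sum, hA.sum_sum_mul_one_sub,
      Finset.sum_ite_eq, Finset.mem_univ, if_true, mul_zero, zero_sub]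
  have hpos : 0 < ∑ i, A i ^ 2 :=
    Finset.sum_pos' (fun i _ => sq_nonneg _) ⟨k, Finset.mem_univ k, by positivity⟩
  have hle : κ * ∑ i, A i ^ 2 ≤ 0 :=
    neg_nonneg.1 (hsum ▸ Finset.sum_nonneg fun i _ => Finset.sum_nonneg fun j _ => hterm i j)
  refine (nonpos_of_mul_nonpos_left hle hpos).lt_of_ne fun h0 => hk ?_
  refine hA.eq_zero_of_sqDist_eq (ν := ν) (fun i j hij => ?_) k
  have hC := E.coupling_mul_sqDist i j hij
  rw [hκ i j hij, h0, zero_mul, zero_mul, zero_eq_mul] at hC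
  exact (sub_eq_zero.1 (hC.resolve_left (mul_pos (hγ i) (hγ j)).ne')).symm

end Dziobek

section SignedArea

variable {S : Type*} [CommRing S] {X Y : Fin 4 → S}

/-- The doubled signed areas of the four triangles spanned by four points of the plane; the signs
are those for which they are the coefficients of an affine relation. -/
def signedArea (X Y : Fin 4 → S) : Fin 4 → S :=
  ![X 1 * (Y 2 - Y 3) + X 2 * (Y 3 - Y 1) + X 3 * (Y 1 - Y 2),
    -(X 0 * (Y 2 - Y 3) + X 2 * (Y 3 - Y 0) + X 3 * (Y 0 - Y 2)),
    X 0 * (Y 1 - Y 3) + X 1 * (Y 3 - Y 0) + X 3 * (Y 0 - Y 1),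
    -(X 0 * (Y 1 - Y 2) + X 1 * (Y 2 - Y 0) + X 2 * (Y 0 - Y 1))]

theorem affineRelation_signedArea (X Y : Fin 4 → S) : AffineRelation (signedArea X Y) X Y := by
  constructor <;> simp only [signedArea, Fin.sum_univ_four, Matrix.cons_val] <;> ring

theorem AffineRelation.mul_signedArea_comm {A : Fin 4 → S} (hA : AffineRelation A X Y)
    (i j : Fin 4) : A i * signedArea X Y j = A j * signedArea X Y i := by
  obtain ⟨h, hX, hY⟩ := hA
  simp only [Fin.sum_univ_four] at h hX hY
  have h01 : A 0 * signedArea X Y 1 = A 1 * signedArea X Y 0 := by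
    simp only [signedArea, Matrix.cons_val]
    linear_combination -((X 2 * Y 3 - X 3 * Y 2) * h + (Y 2 - Y 3) * hX + (X 3 - X 2) * hY)
  have h02 : A 0 * signedArea X Y 2 = A 2 * signedArea X Y 0 := by
    simp only [signedArea, Matrix.cons_val]
    linear_combination (X 1 * Y 3 - X 3 * Y 1) * h + (Y 1 - Y 3) * hX + (X 3 - X 1) * hY
  have h03 : A 0 * signedArea X Y 3 = A 3 * signedArea X Y 0 := by
    simp only [signedArea, Matrix.cons_val]
    linear_combination -((X 1 * Y 2 - X 2 * Y 1) * h + (Y 1 - Y 2) * hX + (X 2 - X 1) * hY)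
  have h12 : A 1 * signedArea X Y 2 = A 2 * signedArea X Y 1 := by
    simp only [signedArea, Matrix.cons_val]
    linear_combination -((X 0 * Y 3 - X 3 * Y 0) * h + (Y 0 - Y 3) * hX + (X 3 - X 0) * hY)
  have h13 : A 1 * signedArea X Y 3 = A 3 * signedArea X Y 1 := by
    simp only [signedArea, Matrix.cons_val]
    linear_combination (X 0 * Y 2 - X 2 * Y 0) * h + (Y 0 - Y 2) * hX + (X 2 - X 0) * hY
  have h23 : A 2 * signedArea X Y 3 = A 3 * signedArea X Y 2 := by
    simp only [signedArea, Matrix.cons_val]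
    linear_combination -((X 0 * Y 1 - X 1 * Y 0) * h + (Y 0 - Y 1) * hX + (X 1 - X 0) * hY)
  fin_cases i <;> fin_cases j <;> first | rfl | assumption | (symm; assumption)

theorem exists_eq_mul_signedArea {C : Fin 4 → Fin 4 → S} (hC : ∀ i j, C i j = C j i)
    (hX : ∀ i, force C X i = 0) (hY : ∀ i, force C Y i = 0) {k : Fin 4}
    (hk : IsUnit (signedArea X Y k)) :
    ∃ κ : S, ∀ i j, i ≠ j → C i j = κ * (signedArea X Y i * signedArea X Y j) := by
  have hrel (i : Fin 4) := affineRelation_of_force_eq_zero (hX i) (hY i)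
  set N : Fin 4 → Fin 4 → S := fun i j => C i j - if i = j then ∑ k, C i k else 0 with hN
  obtain ⟨u, hu⟩ := hk.exists_right_inv
  have hsymm (i : Fin 4) : N i k = N k i := by
    by_cases hik : i = k
    · rw [hik]
    · simp only [hN, hC i k, if_neg hik, if_neg (Ne.symm hik)]
  refine ⟨N k k * u ^ 2, fun i j hij => ?_⟩
  have hCN : C i j = N i j := by simp only [hN, if_neg hij, sub_zero]
  have hi := (hrel i).mul_signedArea_comm j k
  have hk' := (hrel k).mul_signedArea_comm i k
  rw [hCN]
  change N i j * _ = N i k * _ at hi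
  change N k i * _ = N k k * _ at hk'
  rw [hsymm i] at hi
  generalize signedArea X Y k = D at *
  linear_combination u * hi - N i j * hu + signedArea X Y j * u * (u * hk' - N k i * hu)

end SignedArea

section Dual

theorem fst_sqDist {ι : Type*} (X Y : ι → ℝ[ε]) (i j : ι) :
    (sqDist X Y i j).fst = sqDist (fun i => (X i).fst) (fun i => (Y i).fst) i j := by
  simp [sqDist]

theorem fst_signedArea (X Y : Fin 4 → ℝ[ε]) (i : Fin 4) :
    (signedArea X Y i).fst = signedArea (fun i => (X i).fst) (fun i => (Y i).fst) i := by
  fin_cases i <;> simp [signedArea]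

theorem Equilibrium.fst {ι : Type*} [Fintype ι] {γ : ι → ℝ} {X Y : ι → ℝ[ε]} {C : ι → ι → ℝ[ε]}
    {ν : ℝ[ε]} (E : Equilibrium (fun i => inl (γ i)) X Y C ν) :
    Equilibrium γ (fun i => (X i).fst) (fun i => (Y i).fst) (fun i j => (C i j).fst) ν.fst where
  coupling_comm i j := by rw [E.coupling_comm]
  coupling_mul_sqDist i j hij := by
    simpa [fst_sqDist] using congrArg TrivSqZeroExt.fst (E.coupling_mul_sqDist i j hij)
  force_fst i := by simpa [force, fst_sum] using congrArg TrivSqZeroExt.fst (E.force_fst i)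
  force_snd i := by simpa [force, fst_sum] using congrArg TrivSqZeroExt.fst (E.force_snd i)

variable {γ : Fin 4 → ℝ} {X Y : Fin 4 → ℝ[ε]} {C : Fin 4 → Fin 4 → ℝ[ε]} {ν : ℝ[ε]}

theorem Equilibrium.exists_areaSystem (E : Equilibrium (fun i => inl (γ i)) X Y C ν)
    (hγ : ∀ i, 0 < γ i) (hν : 0 < ν.fst) (hs : ∀ i j, i ≠ j → 0 < (sqDist X Y i j).fst) {k : Fin 4}
    (hk : (signedArea X Y k).fst ≠ 0) :
    ∃ a t, AreaSystem (fun i => inl (γ i)) a (fun i j => ν * sqDist X Y i j) t := by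
  obtain ⟨κ, hκ⟩ := exists_eq_mul_signedArea E.coupling_comm E.force_fst E.force_snd
    (isUnit_of_fst_ne_zero hk)
  have hκneg : κ.fst < 0 := by
    refine E.fst.dziobek_neg (affineRelation_signedArea _ _) hγ (k := k)
      (fun i j hij => fst_sqDist X Y i j ▸ hs i j hij) (fun i j hij => ?_)
      (by rwa [← fst_signedArea])
    simpa [fst_signedArea] using congrArg TrivSqZeroExt.fst (hκ i j hij)
  obtain ⟨w, hw⟩ := (isUnit_of_fst_ne_zero hν.ne').exists_right_inv
  have hw0 : 0 < w.fst := by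
    have h : ν.fst * w.fst = 1 := by simpa using congrArg TrivSqZeroExt.fst hw
    exact (pos_iff_pos_of_mul_pos (by rw [h]; exact one_pos)).1 hν
  obtain ⟨r, hr⟩ := exists_mul_self_eq (q := -κ * w)
    (by rw [fst_mul, fst_neg]; exact mul_pos (neg_pos.2 hκneg) hw0)
  refine ⟨fun i => inl (γ i)⁻¹ * (r * signedArea X Y i), _,
    E.areaSystem (affineRelation_signedArea X Y) hκ (r := r) ?_
      (fun i => isUnit_of_fst_ne_zero (by simpa using (hγ i).ne')) fun i => ?_⟩
  · linear_combination ν * hr - κ * hw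
  · rw [← mul_assoc, ← inl_mul, mul_inv_cancel₀ (hγ i).ne', inl_one, one_mul]

theorem AreaSystem.snd_dist_eq_zero {m : ℝ} {a : Fin 4 → ℝ[ε]} {e : Fin 4 → Fin 4 → ℝ[ε]}
    {t : ℝ[ε]} (hm0 : 0 < m) (hm1 : m < 1) (H : AreaSystem ![1, 1, inl m, inl m] a e t)
    (he : ∀ i j, i ≠ j → 0 < (e i j).fst) {i j : Fin 4} (hij : i ≠ j) : (e i j).snd = 0 := by
  have hpos (i j : Fin 4) (hij : i ≠ j) : 0 < 1 - (a i).fst * (a j).fst := by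
    have h : (e i j).fst * (1 - (a i).fst * (a j).fst) = 1 := by
      simpa using congrArg TrivSqZeroExt.fst (H.mul_one_sub i j hij)
    exact (pos_iff_pos_of_mul_pos (by rw [h]; exact one_pos)).1 (he i j hij)
  have h := congrArg TrivSqZeroExt.snd (H.mul_one_sub i j hij)
  rw [DualNumber.snd_mul, snd_sub, DualNumber.snd_mul (a i), H.snd_eq_zero hm0 hm1 hpos i,
    H.snd_eq_zero hm0 hm1 hpos j, snd_one, fst_sub, fst_mul, fst_one] at h
  refine (mul_eq_zero.1 ?_).resolve_right (hpos i j hij).ne'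
  linear_combination h

theorem Equilibrium.snd_mul_sqDist_eq_zero {m : ℝ} (hm0 : 0 < m) (hm1 : m < 1)
    (E : Equilibrium (fun i => inl (![1, 1, m, m] i)) X Y C ν) (hν : 0 < ν.fst)
    (hs : ∀ i j, i ≠ j → 0 < (sqDist X Y i j).fst) {k : Fin 4} (hk : (signedArea X Y k).fst ≠ 0)
    {i j : Fin 4} (hij : i ≠ j) : (ν * sqDist X Y i j).snd = 0 := by
  have hm (i : Fin 4) : 0 < ![1, 1, m, m] i := by fin_cases i <;> simp [hm0]
  obtain ⟨a, t, H⟩ := E.exists_areaSystem hm hν hs hk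
  have hg : (fun i => inl (![1, 1, m, m] i) : Fin 4 → ℝ[ε]) = ![1, 1, inl m, inl m] := by
    funext i
    fin_cases i <;> rfl
  rw [hg] at H
  exact H.snd_dist_eq_zero hm0 hm1
    (fun i j hij => by rw [fst_mul]; exact mul_pos hν (hs i j hij)) hij

end Dual

/-! ### Collinear equilibria -/

section MaximumPrinciples

theorem exists_forall_sub_mul_le {ι : Type*} [Finite ι] [Nontrivial ι] {f : ι → ℝ}
    (hf : Function.Injective f) (y : ι → ℝ) :
    ∃ R i j, f j < f i ∧ y i - R * f i = y j - R * f j ∧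
      ∀ k l, f l < f k → y k - R * f k ≤ y l - R * f l := by
  classical
  cases nonempty_fintype ι
  obtain ⟨a, b, hab⟩ := exists_pair_ne ι
  obtain ⟨⟨i, j⟩, hij, hmax⟩ := Finset.exists_max_image (Finset.univ : Finset ι).offDiag
    (fun p => (y p.1 - y p.2) / (f p.1 - f p.2)) ⟨(a, b), by simpa using hab⟩
  wlog hlt : f j < f i generalizing i j
  · have hne : i ≠ j := by simpa using hij
    refine this j i (by simpa using hne.symm) (fun p hp => (hmax p hp).trans_eq ?_)
      (lt_of_le_of_ne (not_lt.1 hlt) (hf.ne hne))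
    change (y i - y j) / (f i - f j) = (y j - y i) / (f j - f i)
    rw [← neg_sub (y j), ← neg_sub (f j), neg_div_neg_eq]
  refine ⟨(y i - y j) / (f i - f j), i, j, hlt, ?_, fun k l hkl => ?_⟩
  · linear_combination -div_mul_cancel₀ (y i - y j) (sub_pos.2 hlt).ne'
  · have hslope := hmax (k, l) (by simpa using fun h : k = l => hkl.ne (h ▸ rfl))
    rw [div_le_iff₀ (sub_pos.2 hkl)] at hslope
    linarith

variable {ι : Type*} [Fintype ι] {f g w y : ι → ℝ} {ν : ℝ}

theorem eq_of_force_eq_zero {C : ι → ι → ℝ} (hC : ∀ i j, 0 < C i j) (h : ∀ i, force C y i = 0)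
    (i j : ι) : y i = y j := by
  obtain ⟨k, -, hk⟩ := Finset.exists_max_image Finset.univ y ⟨i, Finset.mem_univ i⟩
  have hnonneg (j) (hj : j ∈ Finset.univ) : 0 ≤ C k j * (y k - y j) :=
    mul_nonneg (hC k j).le (sub_nonneg.2 (hk j hj))
  have heq (j : ι) : y k = y j := by
    have := (Finset.sum_eq_zero_iff_of_nonneg hnonneg).1 (h k) j (Finset.mem_univ j)
    exact sub_eq_zero.1 ((mul_eq_zero.1 this).resolve_left (hC k j).ne')
  rw [← heq i, ← heq j]

theorem force_sub_mul {S : Type*} [CommRing S] (C : ι → ι → S) (Y F : ι → S) (r : S) (i : ι) :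
    force C (fun k => Y k - r * F k) i = force C Y i - r * force C F i := by
  simp only [force, Finset.mul_sum, ← Finset.sum_sub_distrib]
  exact Finset.sum_congr rfl fun k _ => by ring

/-- The coupling of vortices with circulations `g i` at the points `f i` of a line, divided by the
circulation of the first vortex. On the diagonal it has the junk value `-(g i * ν)`, which does not
affect forces. -/
def lineCoupling (g f : ι → ℝ) (ν : ℝ) (i j : ι) : ℝ := g j * (((f i - f j) ^ 2)⁻¹ - ν)

/-- In the difference of the forces on `i` and `j` the multiplier `ν` cancels, and every remaining
term is nonnegative. -/
theorem eq_of_force_lineCoupling_eq_zero (hf : Function.Injective f) (hg : ∀ i, 0 < g i)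
    (hw : ∀ i, force (lineCoupling g f ν) w i = 0) (hanti : ∀ k l, f l < f k → w k ≤ w l)
    {i j : ι} (hij : f j < f i) (hwij : w i = w j) (k : ι) : w i = w k := by
  set D : ι → ℝ := fun k => ((f i - f k) ^ 2)⁻¹ - ((f j - f k) ^ 2)⁻¹
  have hsum : ∑ k, g k * (D k * (w i - w k)) = 0 := by
    rw [← sub_eq_zero.2 ((hw i).trans (hw j).symm), force, force, ← Finset.sum_sub_distrib]
    exact Finset.sum_congr rfl fun k _ => by rw [lineCoupling, lineCoupling, hwij]; ring
  have hcases (k : ι) : 0 < D k ∧ w k ≤ w i ∨ D k < 0 ∧ w i ≤ w k ∨ w i = w k := by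
    rcases lt_trichotomy (f i) (f k) with h | h | h
    · have : 0 < (f i - f k) ^ 2 := sq_pos_of_ne_zero (sub_ne_zero.2 h.ne)
      exact .inl ⟨sub_pos.2 (inv_strictAnti₀ this (by nlinarith)), hanti k i h⟩
    · exact .inr (.inr (by rw [hf h]))
    rcases lt_trichotomy (f k) (f j) with h' | h' | h'
    · have : 0 < (f j - f k) ^ 2 := sq_pos_of_ne_zero (sub_ne_zero.2 h'.ne')
      exact .inr (.inl ⟨sub_neg.2 (inv_strictAnti₀ this (by nlinarith)), hwij ▸ hanti j k h'⟩)
    · exact .inr (.inr (by rw [hwij, hf h']))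
    · exact .inr (.inr (le_antisymm (hanti i k h) (hwij ▸ hanti k j h')))
  have hnonneg (k) (_ : k ∈ Finset.univ) : 0 ≤ g k * (D k * (w i - w k)) := by
    refine mul_nonneg (hg k).le ?_
    rcases hcases k with ⟨hDk, h⟩ | ⟨hDk, h⟩ | h
    · exact mul_nonneg hDk.le (sub_nonneg.2 h)
    · exact mul_nonneg_of_nonpos_of_nonpos hDk.le (sub_nonpos.2 h)
    · rw [h, sub_self, mul_zero]
  have hzero := (Finset.sum_eq_zero_iff_of_nonneg hnonneg).1 hsum k (Finset.mem_univ k)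
  have hzero' := (mul_eq_zero.1 hzero).resolve_left (hg k).ne'
  rcases hcases k with ⟨hDk, -⟩ | ⟨hDk, -⟩ | h
  · exact sub_eq_zero.1 ((mul_eq_zero.1 hzero').resolve_left hDk.ne')
  · exact sub_eq_zero.1 ((mul_eq_zero.1 hzero').resolve_left hDk.ne)
  · exact h

theorem exists_sub_eq_mul_of_force_lineCoupling_eq_zero [Nontrivial ι]
    (hf : Function.Injective f) (hg : ∀ i, 0 < g i)
    (hF : ∀ i, force (lineCoupling g f ν) f i = 0)
    (hy : ∀ i, force (lineCoupling g f ν) y i = 0) : ∃ R, ∀ i j, y i - y j = R * (f i - f j) := by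
  obtain ⟨R, i, j, hij, heq, hanti⟩ := exists_forall_sub_mul_le hf y
  have hconst := eq_of_force_lineCoupling_eq_zero (w := fun k => y k - R * f k) hf hg
    (fun i => by rw [force_sub_mul, hy, hF, mul_zero, sub_zero]) hanti hij heq
  exact ⟨R, fun k l => by linear_combination hconst l - hconst k⟩

end MaximumPrinciples

section Collinear

variable {ι : Type*} {X Y : ι → ℝ[ε]} (hs : ∀ i j, i ≠ j → 0 < (sqDist X Y i j).fst)
  (hY : ∀ i, (Y i).fst = 0)

include hY in
theorem fst_sqDist_of_collinear (i j : ι) :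
    (sqDist X Y i j).fst = ((X i).fst - (X j).fst) ^ 2 := by
  simp [sqDist, hY]

include hs hY in
theorem injective_fst_of_collinear : Function.Injective fun i => (X i).fst := by
  intro i j (hij : (X i).fst = (X j).fst)
  by_contra hne
  simpa [fst_sqDist_of_collinear hY, hij] using hs i j hne

end Collinear

namespace Equilibrium

section Collinear

variable {ι : Type*} [Fintype ι] {γ : ι → ℝ} {X Y : ι → ℝ[ε]} {C : ι → ι → ℝ[ε]} {ν : ℝ[ε]}
  (E : Equilibrium (fun i => inl (γ i)) X Y C ν)
  (hs : ∀ i j, i ≠ j → 0 < (sqDist X Y i j).fst) (hY : ∀ i, (Y i).fst = 0)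

include E hs hY

theorem fst_coupling_of_collinear {i j : ι} (hij : i ≠ j) :
    (C i j).fst = γ i * lineCoupling γ (fun i => (X i).fst) ν.fst i j := by
  have h := congrArg TrivSqZeroExt.fst (E.coupling_mul_sqDist i j hij)
  simp only [fst_mul, fst_sub, fst_one, fst_inl, fst_sqDist_of_collinear hY] at h
  have hd := (hs i j hij).ne'
  rw [fst_sqDist_of_collinear hY] at hd
  rw [lineCoupling]
  generalize ((X i).fst - (X j).fst) ^ 2 = s at *
  field_simp
  linear_combination h

theorem snd_coupling_mul_of_collinear {i j : ι} (hij : i ≠ j) :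
    (C i j).snd * ((X i).fst - (X j).fst) =
      -(γ i * (γ j * (ν.snd * ((X i).fst - (X j).fst)
        + 2 * (((X i).fst - (X j).fst) ^ 2)⁻¹ * ((X i).snd - (X j).snd)))) := by
  have hsnd : (sqDist X Y i j).snd =
      2 * (((X i).fst - (X j).fst) * ((X i).snd - (X j).snd)) := by
    simp only [sqDist, sq, snd_add, DualNumber.snd_mul, snd_sub, fst_sub, hY]
    ring
  have h := congrArg TrivSqZeroExt.snd (E.coupling_mul_sqDist i j hij)
  simp only [DualNumber.snd_mul, snd_sub, snd_one, snd_inl, fst_mul, fst_sub, fst_one, fst_inl,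
    fst_sqDist_of_collinear hY, hsnd, E.fst_coupling_of_collinear hs hY hij, lineCoupling] at h
  have hd : (X i).fst - (X j).fst ≠ 0 := sub_ne_zero.2 ((injective_fst_of_collinear hs hY).ne hij)
  generalize (X i).fst - (X j).fst = d at *
  field_simp at h ⊢
  linear_combination h

variable (hγ : ∀ i, 0 < γ i)
include hγ

theorem force_lineCoupling_fst (i : ι) :
    force (lineCoupling γ (fun i => (X i).fst) ν.fst) (fun i => (X i).fst) i = 0 := by
  refine (mul_eq_zero.1 (?_ : γ i * _ = 0)).resolve_left (hγ i).ne'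
  rw [← E.fst.force_fst i, force, force, Finset.mul_sum]
  refine Finset.sum_congr rfl fun j _ => ?_
  rcases eq_or_ne i j with rfl | hij
  · simp
  · rw [E.fst_coupling_of_collinear hs hY hij]
    ring

theorem force_lineCoupling_snd (i : ι) :
    force (lineCoupling γ (fun i => (X i).fst) ν.fst) (fun i => (Y i).snd) i = 0 := by
  have h := congrArg TrivSqZeroExt.snd (E.force_snd i)
  rw [force, snd_sum, snd_zero] at h
  refine (mul_eq_zero.1 (?_ : γ i * _ = 0)).resolve_left (hγ i).ne'
  rw [← h, force, Finset.mul_sum]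
  refine Finset.sum_congr rfl fun j _ => ?_
  rcases eq_or_ne i j with rfl | hij
  · simp
  · rw [DualNumber.snd_mul, fst_sub, snd_sub, hY, hY, E.fst_coupling_of_collinear hs hY hij]
    ring

/-- Adding the dilation by `-ν.snd / (2 * ν.fst)` compensates the variation of `ν`. -/
theorem force_lineCoupling_neg (hν : ν.fst ≠ 0) (i : ι) :
    force (lineCoupling γ (fun i => (X i).fst) (-ν.fst))
      (fun i => (X i).snd - -(ν.snd / (2 * ν.fst)) * (X i).fst) i = 0 := by
  have h := congrArg TrivSqZeroExt.snd (E.force_fst i)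
  rw [force, snd_sum, snd_zero] at h
  refine (mul_eq_zero.1 (?_ : γ i * _ = 0)).resolve_left (hγ i).ne'
  calc γ i * force (lineCoupling γ (fun i => (X i).fst) (-ν.fst))
        (fun i => (X i).snd - -(ν.snd / (2 * ν.fst)) * (X i).fst) i
      = γ i * (ν.snd / (2 * ν.fst)) *
          force (lineCoupling γ (fun i => (X i).fst) ν.fst) (fun i => (X i).fst) i
        - ∑ j, (C i j * (X i - X j)).snd := by
        rw [force, force, Finset.mul_sum, Finset.mul_sum, ← Finset.sum_sub_distrib]
        refine Finset.sum_congr rfl fun j _ => ?_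
        rcases eq_or_ne i j with rfl | hij
        · simp
        · rw [DualNumber.snd_mul, fst_sub, snd_sub, E.snd_coupling_mul_of_collinear hs hY hij,
            E.fst_coupling_of_collinear hs hY hij, lineCoupling, lineCoupling]
          generalize (((X i).fst - (X j).fst) ^ 2)⁻¹ = e
          field_simp
          ring
    _ = 0 := by rw [h, E.force_lineCoupling_fst hs hY hγ, mul_zero, sub_zero]

end Collinear

theorem snd_eq_zero_of_collinear {k : ℕ} {γ : Fin (k + 2) → ℝ} {X Y : Fin (k + 2) → ℝ[ε]}
    {C : Fin (k + 2) → Fin (k + 2) → ℝ[ε]} {ν : ℝ[ε]}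
    (E : Equilibrium (fun i => inl (γ i)) X Y C ν) (hA : Anchored X Y) (hγ : ∀ i, 0 < γ i)
    (hν : 0 < ν.fst) (hs : ∀ i j, i ≠ j → 0 < (sqDist X Y i j).fst) (hY : ∀ i, (Y i).fst = 0)
    (i : Fin (k + 2)) : (X i).snd = 0 ∧ (Y i).snd = 0 := by
  obtain ⟨R, hR⟩ := exists_sub_eq_mul_of_force_lineCoupling_eq_zero
    (injective_fst_of_collinear hs hY) hγ (E.force_lineCoupling_fst hs hY hγ)
    (E.force_lineCoupling_snd hs hY hγ)
  have hpos (i j) : 0 < lineCoupling γ (fun i => (X i).fst) (-ν.fst) i j :=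
    mul_pos (hγ j) (by rw [sub_neg_eq_add]; positivity)
  have hconst := eq_of_force_eq_zero hpos (E.force_lineCoupling_neg hs hY hγ hν.ne')
  have hR0 : R = 0 := by
    simpa [hA.fst_zero, hA.snd_zero, hA.fst_one, hA.snd_one] using (hR 1 0).symm
  have hα : -(ν.snd / (2 * ν.fst)) = 0 := by
    simpa [hA.fst_zero, hA.fst_one] using hconst 1 0
  constructor
  · simpa [hα, hA.fst_zero] using hconst i 0
  · simpa [hR0, hA.snd_zero] using hR i 0

end Equilibrium

/-! ### Rigidity -/

section Rigidity

/-- Infinitesimal rigidity of relative equilibria up to similarity: the collision-free solutions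
over `ℝ[ε]` of the equilibrium equations with two points fixed are constant. -/
def IsRigid {k : ℕ} (Γ : Circulations (k + 2)) : Prop :=
  ∀ (X Y : Fin (k + 2) → ℝ[ε]) (C : Fin (k + 2) → Fin (k + 2) → ℝ[ε]) (ν : ℝ[ε]),
    Equilibrium (fun i => inl (Γ.val i)) X Y C ν → Anchored X Y → 0 < ν.fst →
      (∀ i j, i ≠ j → 0 < (sqDist X Y i j).fst) → ∀ i, (X i).snd = 0 ∧ (Y i).snd = 0

theorem Anchored.snd_eq_zero_of_snd_sqDist {k : ℕ} {X Y : Fin (k + 2) → ℝ[ε]}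
    (hA : Anchored X Y) (h : ∀ i j, (sqDist X Y i j).snd = 0) {l : Fin (k + 2)}
    (hl : (Y l).fst ≠ 0) (i : Fin (k + 2)) : (X i).snd = 0 ∧ (Y i).snd = 0 := by
  simp only [sqDist, sq, snd_add, DualNumber.snd_mul, snd_sub, fst_sub] at h
  have hXY (j) : (X j).snd = 0 ∧ (Y j).fst * (Y j).snd = 0 := by
    have h0 := h 0 j
    have h1 := h 1 j
    simp only [hA.fst_zero, hA.snd_zero, hA.fst_one, hA.snd_one, TrivSqZeroExt.fst_zero,
      TrivSqZeroExt.snd_zero, TrivSqZeroExt.fst_one, TrivSqZeroExt.snd_one] at h0 h1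
    have hX : (X j).snd = 0 := by linear_combination (h0 - h1) / 2
    exact ⟨hX, by linear_combination h0 / 2 - (X j).fst * hX⟩
  have hYl : (Y l).snd = 0 := (mul_eq_zero.1 (hXY l).2).resolve_left hl
  refine ⟨(hXY i).1, (mul_eq_zero.1 (?_ : (Y l).fst * (Y i).snd = 0)).resolve_left hl⟩
  have hil := h i l
  rw [(hXY i).1, (hXY l).1, hYl] at hil
  linear_combination (hXY i).2 - hil / 2

theorem isRigid_pairs {m : ℝ} (hm0 : 0 < m) (hm1 : m < 1) : IsRigid (pairs m hm0) := by
  intro X Y C ν E hA hν hs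
  by_cases hY : ∀ i, (Y i).fst = 0
  · exact E.snd_eq_zero_of_collinear hA (pairs m hm0).pos hν hs hY
  obtain ⟨l, hl⟩ := not_forall.1 hY
  obtain ⟨k, hk⟩ : ∃ k, (signedArea X Y k).fst ≠ 0 := by
    fin_cases l
    · simp [hA.snd_zero] at hl
    · simp [hA.snd_one] at hl
    · exact ⟨3, by simpa [signedArea, hA.fst_zero, hA.snd_zero, hA.fst_one, hA.snd_one] using hl⟩
    · exact ⟨2, by simpa [signedArea, hA.fst_zero, hA.snd_zero, hA.fst_one, hA.snd_one] using hl⟩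
  have hprod {i j : Fin 4} (hij : i ≠ j) : (ν * sqDist X Y i j).snd = 0 :=
    E.snd_mul_sqDist_eq_zero hm0 hm1 hν hs hk hij
  have hν0 : ν.snd = 0 := by
    simpa [sqDist, hA.fst_zero, hA.snd_zero, hA.fst_one, hA.snd_one] using hprod zero_ne_one
  refine hA.snd_eq_zero_of_snd_sqDist (fun i j => ?_) hl
  rcases eq_or_ne i j with rfl | hij
  · rw [sqDist_self, snd_zero]
  · have h := hprod hij
    rw [DualNumber.snd_mul, hν0, zero_mul, add_zero] at h
    exact (mul_eq_zero.1 h).resolve_left hν.ne'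

end Rigidity

/-! ### Derivatives of the energy -/

section Jets

/-- `A` is the first-order jet at `0` of the curve `φ`: its value and its derivative. -/
def HasJet (φ : ℝ → ℝ) (A : ℝ[ε]) : Prop := φ 0 = A.fst ∧ HasDerivAt φ A.snd 0

namespace HasJet

variable {φ ψ : ℝ → ℝ} {A B : ℝ[ε]}

theorem const (c : ℝ) : HasJet (fun _ => c) (inl c) :=
  ⟨rfl, hasDerivAt_const 0 c⟩

theorem add (h : HasJet φ A) (h' : HasJet ψ B) : HasJet (fun t => φ t + ψ t) (A + B) :=
  ⟨congrArg₂ (· + ·) h.1 h'.1, h.2.fun_add h'.2⟩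

theorem sub (h : HasJet φ A) (h' : HasJet ψ B) : HasJet (fun t => φ t - ψ t) (A - B) :=
  ⟨congrArg₂ (· - ·) h.1 h'.1, h.2.fun_sub h'.2⟩

theorem mul (h : HasJet φ A) (h' : HasJet ψ B) : HasJet (fun t => φ t * ψ t) (A * B) := by
  refine ⟨congrArg₂ (· * ·) h.1 h'.1, (h.2.fun_mul h'.2).congr_deriv ?_⟩
  rw [h.1, h'.1, DualNumber.snd_mul, add_comm]

theorem sq (h : HasJet φ A) : HasJet (fun t => φ t ^ 2) (A ^ 2) := by
  simpa only [pow_two] using h.mul h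

theorem inv (h : HasJet φ A) (hA : A.fst ≠ 0) : HasJet (fun t => (φ t)⁻¹) A⁻¹ := by
  refine ⟨(congrArg (·⁻¹) h.1).trans (fst_inv A).symm, (h.2.fun_inv (by rwa [h.1])).congr_deriv ?_⟩
  rw [h.1, snd_inv, op_smul_eq_mul, smul_eq_mul]
  field_simp

theorem sum {ι : Type*} {s : Finset ι} {φ : ι → ℝ → ℝ} {A : ι → ℝ[ε]}
    (h : ∀ i ∈ s, HasJet (φ i) (A i)) : HasJet (fun t => ∑ i ∈ s, φ i t) (∑ i ∈ s, A i) := by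
  constructor
  · rw [fst_sum]
    exact Finset.sum_congr rfl fun i hi => (h i hi).1
  · rw [snd_sum]
    exact HasDerivAt.fun_sum fun i hi => (h i hi).2

theorem pairSum {n : ℕ} {φ : Fin n → Fin n → ℝ → ℝ} {A : Fin n → Fin n → ℝ[ε]}
    (h : ∀ i j, HasJet (φ i j) (A i j)) :
    HasJet (fun t => Vortex.pairSum fun i j => φ i j t) (Vortex.pairSum A) :=
  sum fun i _ => sum fun j _ => h i j

theorem sqDist {ι : Type*} {x y : ℝ → ι → ℝ} {X Y : ι → ℝ[ε]}
    (hx : ∀ i, HasJet (fun t => x t i) (X i))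
    (hy : ∀ i, HasJet (fun t => y t i) (Y i)) (i j : ι) :
    HasJet (fun t => Vortex.sqDist (x t) (y t) i j) (Vortex.sqDist X Y i j) :=
  ((hx i).sub (hx j)).sq.add ((hy i).sub (hy j)).sq

theorem eq_zero (h : HasJet φ A) (h0 : φ 0 = 0) (h1 : HasDerivAt φ 0 0) : A = 0 :=
  TrivSqZeroExt.ext (h.1.symm.trans h0) (h.2.unique h1)

end HasJet

end Jets

section Coupling

variable {n : ℕ} {S : Type*} [CommRing S] [Inv S]

/-- The multiplier `ν = L / J` of the equilibrium equations, where `L = ∑_{i<j} Γᵢ Γⱼ` and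
`J = ∑_{i<j} Γᵢ Γⱼ sᵢⱼ`. -/
def multiplier (g X Y : Fin n → S) : S :=
  pairSum (fun i j => g i * g j) * (pairSum fun i j => g i * g j * sqDist X Y i j)⁻¹

/-- The coefficients `Cᵢⱼ = Γᵢ Γⱼ (sᵢⱼ⁻¹ - ν)` of the equilibrium equations. -/
def coupling (g X Y : Fin n → S) (i j : Fin n) : S :=
  if i = j then 0 else g i * g j * ((sqDist X Y i j)⁻¹ - multiplier g X Y)

theorem coupling_comm (g X Y : Fin n → S) (i j : Fin n) :
    coupling g X Y i j = coupling g X Y j i := by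
  simp only [coupling, eq_comm (a := i), mul_comm (g i), sqDist_comm X Y i]

end Coupling

section DualCoupling

variable {k : ℕ} {g : Fin (k + 2) → ℝ} (hg : ∀ i, 0 < g i) {X Y : Fin (k + 2) → ℝ[ε]}
  (hs : ∀ i j, i ≠ j → 0 < (sqDist X Y i j).fst)
include hg

theorem fst_pairSum_pos {s : Fin (k + 2) → Fin (k + 2) → ℝ[ε]}
    (hs : ∀ i j, i ≠ j → 0 < (s i j).fst) :
    0 < (pairSum fun i j => inl (g i) * inl (g j) * s i j).fst := by
  have h := pairSum_pos fun i j hij => mul_pos (mul_pos (hg i) (hg j)) (hs i j hij)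
  simpa only [pairSum, fst_sum, fst_mul, fst_inl] using h

include hs

theorem fst_multiplier_pos : 0 < (multiplier (fun i => inl (g i)) X Y).fst := by
  rw [multiplier, fst_mul, fst_inv]
  refine mul_pos ?_ (inv_pos.2 (fst_pairSum_pos hg hs))
  simpa using fst_pairSum_pos hg (s := 1) fun _ _ _ => one_pos

theorem equilibrium_coupling (hA : Anchored X Y)
    (hX : ∀ j : Fin k, force (coupling (fun i => inl (g i)) X Y) X j.succ.succ = 0)
    (hY : ∀ j : Fin k, force (coupling (fun i => inl (g i)) X Y) Y j.succ.succ = 0) :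
    Equilibrium (fun i => inl (g i)) X Y (coupling (fun i => inl (g i)) X Y)
      (multiplier (fun i => inl (g i)) X Y) := by
  have hmul (i j) (hij : i ≠ j) : coupling (fun i => inl (g i)) X Y i j * sqDist X Y i j =
      inl (g i) * inl (g j) * (1 - multiplier (fun i => inl (g i)) X Y * sqDist X Y i j) := by
    have h := TrivSqZeroExt.inv_mul_cancel (hs i j hij).ne'
    rw [coupling, if_neg hij]
    linear_combination inl (g i) * inl (g j) * h
  have hscale :
      pairSum (fun i j => coupling (fun i => inl (g i)) X Y i j * sqDist X Y i j) = 0 := by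
    rw [pairSum_congr hmul]
    simp only [mul_sub, mul_one, mul_left_comm _ (multiplier _ X Y), pairSum_sub, ← mul_pairSum]
    rw [multiplier, mul_assoc, TrivSqZeroExt.inv_mul_cancel (fst_pairSum_pos hg hs).ne', mul_one,
      sub_self]
  obtain ⟨hX', hY'⟩ := hA.force_eq_zero (coupling_comm _ X Y) hscale hX hY
  exact ⟨coupling_comm _ X Y, hmul, hX', hY'⟩

end DualCoupling

namespace HasJet

variable {k : ℕ} {x y : ℝ → Fin (k + 2) → ℝ} {X Y : Fin (k + 2) → ℝ[ε]} {g : Fin (k + 2) → ℝ}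
  (hg : ∀ i, 0 < g i) (hx : ∀ i, HasJet (fun t => x t i) (X i))
  (hy : ∀ i, HasJet (fun t => y t i) (Y i)) (hs : ∀ i j, i ≠ j → 0 < (Vortex.sqDist X Y i j).fst)
include hg hx hy hs

theorem multiplier : HasJet (fun t => Vortex.multiplier g (x t) (y t))
    (Vortex.multiplier (fun i => inl (g i)) X Y) :=
  (pairSum fun i j => (const (g i)).mul (const (g j))).mul
    ((pairSum fun i j => ((const (g i)).mul (const (g j))).mul (sqDist hx hy i j)).inv
      (fst_pairSum_pos hg hs).ne')

theorem coupling (i j : Fin (k + 2)) : HasJet (fun t => Vortex.coupling g (x t) (y t) i j)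
    (Vortex.coupling (fun i => inl (g i)) X Y i j) := by
  by_cases hij : i = j
  · simpa only [Vortex.coupling, if_pos hij, inl_zero] using const 0
  · simp only [Vortex.coupling, if_neg hij]
    exact ((const _).mul (const _)).mul
      (((sqDist hx hy i j).inv (hs i j hij).ne').sub (multiplier hg hx hy hs))

theorem force {z : ℝ → Fin (k + 2) → ℝ} {Z : Fin (k + 2) → ℝ[ε]}
    (hz : ∀ i, HasJet (fun t => z t i) (Z i)) (i : Fin (k + 2)) :
    HasJet (fun t => Vortex.force (Vortex.coupling g (x t) (y t)) (z t) i)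
      (Vortex.force (Vortex.coupling (fun i => inl (g i)) X Y) Z i) :=
  sum fun j _ => (coupling hg hx hy hs i j).mul ((hz i).sub (hz j))

end HasJet

section Energy

variable {n : ℕ}

/-- The Hamiltonian in homogeneous form, `-½ ∑_{i<j} Γᵢ Γⱼ log sᵢⱼ + ½ L log J`. -/
def energy (g x y : Fin n → ℝ) : ℝ :=
  -(1 / 2) * pairSum (fun i j => g i * g j * Real.log (sqDist x y i j)) +
    1 / 2 * pairSum (fun i j => g i * g j) *
      Real.log (pairSum fun i j => g i * g j * sqDist x y i j)

theorem hasDerivAt_pairSum {φ : Fin n → Fin n → ℝ → ℝ} {φ' : Fin n → Fin n → ℝ} {t : ℝ}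
    (h : ∀ i j, i ≠ j → HasDerivAt (φ i j) (φ' i j) t) :
    HasDerivAt (fun t => pairSum fun i j => φ i j t) (pairSum φ') t :=
  HasDerivAt.fun_sum fun i _ => HasDerivAt.fun_sum fun j hj => h i j (Finset.mem_Ioi.1 hj).ne

theorem hasDerivAt_sqDist {ι : Type*} {x y : ℝ → ι → ℝ} {u v : ι → ℝ} {t : ℝ}
    (hx : ∀ i, HasDerivAt (fun t => x t i) (u i) t)
    (hy : ∀ i, HasDerivAt (fun t => y t i) (v i) t) (i j : ι) :
    HasDerivAt (fun t => sqDist (x t) (y t) i j)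
      (2 * ((x t i - x t j) * (u i - u j) + (y t i - y t j) * (v i - v j))) t := by
  refine ((((hx i).fun_sub (hx j)).fun_pow 2).fun_add
    (((hy i).fun_sub (hy j)).fun_pow 2)).congr_deriv ?_
  push_cast
  ring

theorem hasDerivAt_energy {k : ℕ} {g : Fin (k + 2) → ℝ} (hg : ∀ i, 0 < g i)
    {x y : ℝ → Fin (k + 2) → ℝ} {u v : Fin (k + 2) → ℝ} {t : ℝ}
    (hx : ∀ i, HasDerivAt (fun t => x t i) (u i) t)
    (hy : ∀ i, HasDerivAt (fun t => y t i) (v i) t)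
    (hs : ∀ i j, i ≠ j → 0 < sqDist (x t) (y t) i j) :
    HasDerivAt (fun t => energy g (x t) (y t))
      (-∑ i, (u i * force (coupling g (x t) (y t)) (x t) i
        + v i * force (coupling g (x t) (y t)) (y t) i)) t := by
  have hJ : 0 < pairSum fun i j => g i * g j * sqDist (x t) (y t) i j :=
    pairSum_pos fun i j hij => mul_pos (mul_pos (hg i) (hg j)) (hs i j hij)
  have hlog := hasDerivAt_pairSum fun i j hij =>
    ((hasDerivAt_sqDist hx hy i j).log (hs i j hij).ne').const_mul (g i * g j)
  have hlogJ := (hasDerivAt_pairSum fun i j _ =>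
    (hasDerivAt_sqDist hx hy i j).const_mul (g i * g j)).log hJ.ne'
  refine ((hlog.const_mul (-(1 / 2))).fun_add
    (hlogJ.const_mul (1 / 2 * pairSum fun i j => g i * g j))).congr_deriv ?_
  set d : Fin (k + 2) → Fin (k + 2) → ℝ := fun i j =>
    (x t i - x t j) * (u i - u j) + (y t i - y t j) * (v i - v j)
  have htwo (e : Fin (k + 2) → Fin (k + 2) → ℝ) :
      (pairSum fun i j => g i * g j * (2 * e i j)) = 2 * pairSum fun i j => g i * g j * e i j := by
    rw [mul_pairSum]
    exact pairSum_congr fun i j _ => by ring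
  have hforce : ∑ i, (u i * force (coupling g (x t) (y t)) (x t) i
      + v i * force (coupling g (x t) (y t)) (y t) i) =
      (pairSum fun i j => g i * g j * (d i j / sqDist (x t) (y t) i j))
        - multiplier g (x t) (y t) * pairSum fun i j => g i * g j * d i j := by
    rw [Finset.sum_add_distrib, sum_mul_force (coupling_comm g _ _),
      sum_mul_force (coupling_comm g _ _), mul_pairSum, ← pairSum_sub]
    simp only [pairSum, ← Finset.sum_add_distrib]
    exact pairSum_congr fun i j hij => by rw [coupling, if_neg hij]; ring
  rw [hforce, multiplier, htwo]
  simp only [mul_div_assoc, htwo]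
  ring

end Energy

section ShapeEnergy

variable {k : ℕ}

theorem hasDerivAt_add_smul {F : Type*} [NormedAddCommGroup F] [NormedSpace ℝ F] (w u : F) :
    HasDerivAt (fun t : ℝ => w + t • u) u 0 := by
  simpa using ((hasDerivAt_id (0 : ℝ)).smul_const u).const_add w

/-- The variation of the configuration `frame w` in the direction `u`. -/
def frameVariation (u : Fin k → ℂ) : Fin (k + 2) → ℂ :=
  Matrix.vecCons 0 (Matrix.vecCons 0 u)

theorem frame_add_smul (w u : Fin k → ℂ) (t : ℝ) (i : Fin (k + 2)) :
    frame (w + t • u) i = frame w i + t • frameVariation u i := by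
  refine Fin.cases ?_ (Fin.cases ?_ fun j => ?_) i <;> simp [frame, frameVariation]

theorem hasDerivAt_frame (part : ℂ →L[ℝ] ℝ) (w u : Fin k → ℂ) (i : Fin (k + 2)) :
    HasDerivAt (fun t : ℝ => part (frame (w + t • u) i)) (part (frameVariation u i)) 0 := by
  simp only [frame_add_smul, map_add, map_smul]
  exact hasDerivAt_add_smul _ _

theorem sqDist_re_im {ι : Type*} (z : ι → ℂ) (i j : ι) :
    sqDist (fun i => (z i).re) (fun i => (z i).im) i j = ‖z i - z j‖ ^ 2 := by
  rw [Complex.sq_norm, Complex.normSq_apply, sqDist, Complex.sub_re, Complex.sub_im]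
  ring

theorem sqDist_frame_pos {w : Fin k → ℂ} (hw : w ∈ shapes k) (i j : Fin (k + 2)) (hij : i ≠ j) :
    0 < sqDist (fun i => (frame w i).re) (fun i => (frame w i).im) i j := by
  rw [sqDist_re_im]
  have : frame w i - frame w j ≠ 0 := fun h => hw ⟨i, j, hij, sub_eq_zero.1 h⟩
  positivity

theorem sum_mul_sum_mul_sub_sq {n : ℕ} {S : Type*} [CommRing S] {g x : Fin n → S} {c : S}
    (hc : (∑ i, g i) * c = ∑ i, g i * x i) :
    (∑ i, g i) * ∑ i, g i * (x i - c) ^ 2 = pairSum fun i j => g i * g j * (x i - x j) ^ 2 := by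
  have hforce (i : Fin n) :
      force (fun i j => g i * g j) x i = (∑ i, g i) * (g i * (x i - c)) := by
    calc force (fun i j => g i * g j) x i = g i * (x i * ∑ j, g j - ∑ j, g j * x j) := by
          rw [force, Finset.mul_sum, ← Finset.sum_sub_distrib, Finset.mul_sum]
          exact Finset.sum_congr rfl fun j _ => by ring
      _ = (∑ i, g i) * (g i * (x i - c)) := by rw [← hc]; ring
  have hcenter : ∑ i, g i * (x i - c) = 0 := by
    simp only [mul_sub, Finset.sum_sub_distrib, ← Finset.sum_mul, hc, sub_self]
  calc (∑ i, g i) * ∑ i, g i * (x i - c) ^ 2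
      = ∑ i, x i * force (fun i j => g i * g j) x i
        - c * (∑ i, g i) * ∑ i, g i * (x i - c) := by
        simp only [hforce, Finset.mul_sum _ _ (_ * _), Finset.mul_sum _ _ (∑ i, g i),
          ← Finset.sum_sub_distrib]
        exact Finset.sum_congr rfl fun i _ => by ring
    _ = pairSum fun i j => g i * g j * (x i - x j) ^ 2 := by
        rw [hcenter, mul_zero, sub_zero, sum_mul_force fun i j => mul_comm _ _]
        exact pairSum_congr fun i j _ => by ring

variable (Γ : Circulations (k + 2))

/-- The Hamiltonian in shape coordinates, up to the additive constant `energyShift`. -/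
def shapeEnergy (w : Fin k → ℂ) : ℝ :=
  energy Γ.val (fun i => (frame w i).re) (fun i => (frame w i).im)

/-- The additive constant between the Hamiltonian and `shapeEnergy`. -/
def energyShift : ℝ :=
  -(1 / 2) * (pairSum fun i j => Γ.val i * Γ.val j) * Real.log (∑ i, Γ.val i)

theorem sum_mul_impulse (z : Fin (k + 2) → ℂ) : (∑ i, Γ.val i) * impulse Γ z =
    pairSum fun i j => Γ.val i * Γ.val j * sqDist (fun i => (z i).re) (fun i => (z i).im) i j := by
  have hc : ((∑ i, Γ.val i : ℝ) : ℂ) * center Γ z = ∑ i, (Γ.val i : ℂ) * z i :=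
    mul_inv_cancel_left₀ (Complex.ofReal_ne_zero.2 (sum_pos' Γ).ne') _
  have hre := sum_mul_sum_mul_sub_sq (x := fun i => (z i).re) (c := (center Γ z).re)
    (by simpa using congrArg Complex.re hc)
  have him := sum_mul_sum_mul_sub_sq (x := fun i => (z i).im) (c := (center Γ z).im)
    (by simpa using congrArg Complex.im hc)
  have himpulse : impulse Γ z = ∑ i, Γ.val i * ((z i).re - (center Γ z).re) ^ 2
      + ∑ i, Γ.val i * ((z i).im - (center Γ z).im) ^ 2 := by
    rw [impulse, ← Finset.sum_add_distrib]
    refine Finset.sum_congr rfl fun i _ => ?_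
    rw [Complex.sq_norm, Complex.normSq_apply, Complex.sub_re, Complex.sub_im]
    ring
  rw [himpulse, mul_add, hre, him]
  simp only [pairSum, ← Finset.sum_add_distrib, ← mul_add, sqDist]

theorem hamiltonian_rep {w : Fin k → ℂ} (hw : w ∈ shapes k) :
    hamiltonian Γ (rep Γ w) = shapeEnergy Γ w + energyShift Γ := by
  have hI := impulse_frame_pos Γ w
  have hlog (i j) (hij : i ≠ j) : Γ.val i * Γ.val j * Real.log ‖rep Γ w i - rep Γ w j‖ =
      1 / 2 * (Γ.val i * Γ.val j * Real.log (sqDist (fun i => (frame w i).re)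
        (fun i => (frame w i).im) i j))
      - 1 / 2 * Real.log (impulse Γ (frame w)) * (Γ.val i * Γ.val j) := by
    have hne : frame w i - frame w j ≠ 0 := fun h => hw ⟨i, j, hij, sub_eq_zero.1 h⟩
    have hscale := inv_pos.2 (sqrt_impulse_pos Γ w)
    rw [rep, rep, ← mul_sub, sub_sub_sub_cancel_right, norm_mul, Complex.norm_real,
      Real.norm_of_nonneg hscale.le, Real.log_mul hscale.ne' (norm_ne_zero_iff.2 hne),
      Real.log_inv, Real.log_sqrt hI.le, sqDist_re_im, Real.log_pow]
    push_cast
    ring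
  have hham : hamiltonian Γ (rep Γ w) =
      -pairSum fun i j => Γ.val i * Γ.val j * Real.log ‖rep Γ w i - rep Γ w j‖ := rfl
  rw [hham, pairSum_congr hlog, pairSum_sub, ← mul_pairSum, ← mul_pairSum, shapeEnergy, energy,
    energyShift, ← sum_mul_impulse, Real.log_mul (sum_pos' Γ).ne' hI.ne']
  ring

theorem contDiffAt_shapeEnergy {w : Fin k → ℂ} (hw : w ∈ shapes k) :
    ContDiffAt ℝ ∞ (shapeEnergy Γ) w := by
  have hpart (part : ℂ →L[ℝ] ℝ) (i : Fin (k + 2)) :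
      ContDiffAt ℝ ∞ (fun w : Fin k → ℂ => part (frame w i)) w :=
    (part.contDiff.comp (contDiff_frame i)).contDiffAt
  have hsq (i j : Fin (k + 2)) : ContDiffAt ℝ ∞ (fun w : Fin k → ℂ =>
      sqDist (fun i => (frame w i).re) (fun i => (frame w i).im) i j) w :=
    (((hpart Complex.reCLM i).sub (hpart Complex.reCLM j)).pow 2).add
      (((hpart Complex.imCLM i).sub (hpart Complex.imCLM j)).pow 2)
  have hsum {φ : Fin (k + 2) → Fin (k + 2) → (Fin k → ℂ) → ℝ}
      (h : ∀ i j, i ≠ j → ContDiffAt ℝ ∞ (φ i j) w) :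
      ContDiffAt ℝ ∞ (fun w => pairSum fun i j => φ i j w) w :=
    ContDiffAt.sum fun i _ => ContDiffAt.sum fun j hj => h i j (Finset.mem_Ioi.1 hj).ne
  have hJ : 0 < pairSum fun i j => Γ.val i * Γ.val j *
      sqDist (fun i => (frame w i).re) (fun i => (frame w i).im) i j :=
    pairSum_pos fun i j h => mul_pos (mul_pos (Γ.pos i) (Γ.pos j)) (sqDist_frame_pos hw i j h)
  exact (contDiffAt_const.mul (hsum fun i j h =>
    contDiffAt_const.mul ((hsq i j).log (sqDist_frame_pos hw i j h).ne'))).add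
    (contDiffAt_const.mul ((hsum fun i j _ => contDiffAt_const.mul (hsq i j)).log hJ.ne'))

end ShapeEnergy

section Hessian

variable {k : ℕ} (Γ : Circulations (k + 2))

/-- The coupling of the configuration `frame w`. -/
def shapeCoupling (w : Fin k → ℂ) : Fin (k + 2) → Fin (k + 2) → ℝ :=
  coupling Γ.val (fun i => (frame w i).re) (fun i => (frame w i).im)

variable {Γ} {w : Fin k → ℂ} (hw : w ∈ shapes k)
include hw

theorem fderiv_shapeEnergy (u : Fin k → ℂ) :
    fderiv ℝ (shapeEnergy Γ) w u = -∑ j : Fin k,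
      ((u j).re * force (shapeCoupling Γ w) (fun i => (frame w i).re) j.succ.succ
        + (u j).im * force (shapeCoupling Γ w) (fun i => (frame w i).im) j.succ.succ) := by
  have hderiv : HasDerivAt (fun t : ℝ => shapeEnergy Γ (w + t • u))
      (fderiv ℝ (shapeEnergy Γ) w u) 0 :=
    HasFDerivAt.comp_hasDerivAt_of_eq (0 : ℝ)
      ((contDiffAt_shapeEnergy Γ hw).differentiableAt (by simp)).hasFDerivAt
      (hasDerivAt_add_smul w u) (by simp)
  rw [hderiv.unique (hasDerivAt_energy Γ.pos (hasDerivAt_frame Complex.reCLM w u)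
    (hasDerivAt_frame Complex.imCLM w u) (by simpa using sqDist_frame_pos hw))]
  simp [Fin.sum_univ_succ, frameVariation, shapeCoupling]

theorem fderiv_shapeEnergy_single_one (j : Fin k) :
    fderiv ℝ (shapeEnergy Γ) w (Pi.single j 1) =
      -force (shapeCoupling Γ w) (fun i => (frame w i).re) j.succ.succ := by
  rw [fderiv_shapeEnergy hw, Finset.sum_eq_single j (fun i _ hij => by simp [hij]) (by simp)]
  simp

theorem fderiv_shapeEnergy_single_I (j : Fin k) :
    fderiv ℝ (shapeEnergy Γ) w (Pi.single j Complex.I) =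
      -force (shapeCoupling Γ w) (fun i => (frame w i).im) j.succ.succ := by
  rw [fderiv_shapeEnergy hw, Finset.sum_eq_single j (fun i _ hij => by simp [hij]) (by simp)]
  simp

end Hessian

section HessianKernel

variable {k : ℕ}

/-- The configuration `frame (w + ε v)` over `ℝ[ε]`; `part` selects the real or the imaginary
parts. -/
def frameJet (part : ℂ →L[ℝ] ℝ) (w v : Fin k → ℂ) (i : Fin (k + 2)) : ℝ[ε] :=
  inl (part (frame w i)) + inr (part (frameVariation v i))

theorem hasJet_frameJet (part : ℂ →L[ℝ] ℝ) (w v : Fin k → ℂ) (i : Fin (k + 2)) :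
    HasJet (fun t : ℝ => part (frame (w + t • v) i)) (frameJet part w v i) :=
  ⟨by simp [frameJet], by simpa [frameJet] using hasDerivAt_frame part w v i⟩

theorem anchored_frameJet (w v : Fin k → ℂ) :
    Anchored (frameJet Complex.reCLM w v) (frameJet Complex.imCLM w v) := by
  constructor <;> simp [frameJet, frame, frameVariation]

variable {Γ : Circulations (k + 2)} {w v : Fin k → ℂ} (hw : w ∈ shapes k)
include hw

theorem fst_sqDist_frameJet_pos (v : Fin k → ℂ) (i j : Fin (k + 2)) (hij : i ≠ j) :
    0 < (sqDist (frameJet Complex.reCLM w v) (frameJet Complex.imCLM w v) i j).fst := by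
  simpa [fst_sqDist, frameJet] using sqDist_frame_pos hw i j hij

theorem hasDerivAt_fderiv_shapeEnergy
    (hv : ∀ u, fderiv ℝ (fderiv ℝ (shapeEnergy Γ)) w v u = 0) (u : Fin k → ℂ) :
    HasDerivAt (fun t : ℝ => fderiv ℝ (shapeEnergy Γ) (w + t • v) u) 0 0 := by
  have hd := (((contDiffAt_shapeEnergy Γ hw).fderiv_right (m := 1) (by norm_cast)).differentiableAt
    (by simp)).hasFDerivAt
  have hcurve := HasFDerivAt.comp_hasDerivAt_of_eq (0 : ℝ) hd (hasDerivAt_add_smul w v) (by simp)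
  simpa [hv u] using hcurve.clm_apply (hasDerivAt_const (0 : ℝ) u)

theorem eq_zero_of_hasJet (hcrit : fderiv ℝ (shapeEnergy Γ) w = 0)
    (hv : ∀ u, fderiv ℝ (fderiv ℝ (shapeEnergy Γ)) w v u = 0) {u : Fin k → ℂ}
    {f : (Fin k → ℂ) → ℝ} (hf : ∀ w ∈ shapes k, fderiv ℝ (shapeEnergy Γ) w u = -f w) {A : ℝ[ε]}
    (hA : HasJet (fun t : ℝ => f (w + t • v)) A) : A = 0 := by
  have hmem : ∀ᶠ t : ℝ in nhds 0, w + t • v ∈ shapes k :=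
    (hasDerivAt_add_smul w v).continuousAt.eventually_mem
      (isOpen_shapes.mem_nhds (by simpa using hw))
  refine hA.eq_zero ?_ ?_
  · simpa [hcrit] using (hf w hw).symm
  · refine ((hasDerivAt_fderiv_shapeEnergy hw hv u).fun_neg.congr_of_eventuallyEq
      ?_).congr_deriv neg_zero
    filter_upwards [hmem] with t ht
    rw [hf _ ht, neg_neg]

theorem equilibrium_frameJet (hcrit : fderiv ℝ (shapeEnergy Γ) w = 0)
    (hv : ∀ u, fderiv ℝ (fderiv ℝ (shapeEnergy Γ)) w v u = 0) :
    Equilibrium (fun i => inl (Γ.val i)) (frameJet Complex.reCLM w v)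
      (frameJet Complex.imCLM w v)
      (coupling (fun i => inl (Γ.val i)) (frameJet Complex.reCLM w v)
        (frameJet Complex.imCLM w v))
      (multiplier (fun i => inl (Γ.val i)) (frameJet Complex.reCLM w v)
        (frameJet Complex.imCLM w v)) := by
  have hforce (part : ℂ →L[ℝ] ℝ) := HasJet.force Γ.pos (hasJet_frameJet Complex.reCLM w v)
    (hasJet_frameJet Complex.imCLM w v) (fst_sqDist_frameJet_pos hw v) (hasJet_frameJet part w v)
  exact equilibrium_coupling Γ.pos (fst_sqDist_frameJet_pos hw v) (anchored_frameJet w v)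
    (fun j => eq_zero_of_hasJet hw hcrit hv
      (fun _ hw => fderiv_shapeEnergy_single_one hw j)
      (hforce Complex.reCLM j.succ.succ))
    (fun j => eq_zero_of_hasJet hw hcrit hv
      (fun _ hw => fderiv_shapeEnergy_single_I hw j)
      (hforce Complex.imCLM j.succ.succ))

theorem IsRigid.eq_zero_of_fderiv_fderiv (hΓ : IsRigid Γ)
    (hcrit : fderiv ℝ (shapeEnergy Γ) w = 0)
    (hv : ∀ u, fderiv ℝ (fderiv ℝ (shapeEnergy Γ)) w v u = 0) : v = 0 := by
  have hconst := hΓ _ _ _ _ (equilibrium_frameJet hw hcrit hv) (anchored_frameJet w v)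
    (fst_multiplier_pos Γ.pos (fst_sqDist_frameJet_pos hw v)) (fst_sqDist_frameJet_pos hw v)
  funext j
  obtain ⟨hre, him⟩ := hconst j.succ.succ
  exact Complex.ext (by simpa [frameJet, frameVariation] using hre)
    (by simpa [frameJet, frameVariation] using him)

end HessianKernel

section ReducedHamiltonian

variable {k : ℕ} (Γ : Circulations (k + 2))

theorem reducedHamiltonian_symm {w : Fin k → ℂ} (hw : w ∈ shapes k) :
    reducedHamiltonian Γ ((shapeChart Γ).symm w) = shapeEnergy Γ w + energyShift Γ := by
  have hsymm : (shapeChart Γ).symm w = proj Γ ⟨rep Γ w, rep_mem Γ hw⟩ := dif_pos hw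
  rw [hsymm]
  exact hamiltonian_rep Γ hw

theorem shapeChart_mem (p : Reduced Γ) : shapeChart Γ p ∈ shapes k :=
  (shapeChart Γ).map_source (Set.mem_univ p)

theorem reducedHamiltonian_eq (p : Reduced Γ) :
    reducedHamiltonian Γ p = shapeEnergy Γ (shapeChart Γ p) + energyShift Γ := by
  rw [← reducedHamiltonian_symm Γ (shapeChart_mem Γ p), (shapeChart Γ).left_inv (Set.mem_univ p)]

theorem contMDiff_reducedHamiltonian :
    ContMDiff 𝓘(ℝ, Fin k → ℂ) 𝓘(ℝ, ℝ) ∞ (reducedHamiltonian Γ) := by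
  intro p
  have henergy : ContDiffAt ℝ ∞ (fun w => shapeEnergy Γ w + energyShift Γ)
      (extChartAt 𝓘(ℝ, Fin k → ℂ) p p) :=
    (contDiffAt_shapeEnergy Γ (shapeChart_mem Γ p)).add contDiffAt_const
  exact (henergy.contMDiffAt.comp p contMDiffAt_extChartAt).congr_of_eventuallyEq
    (Filter.Eventually.of_forall (reducedHamiltonian_eq Γ))

theorem reducedHamiltonian_comp_symm_eventuallyEq (p : Reduced Γ) :
    reducedHamiltonian Γ ∘ (extChartAt 𝓘(ℝ, Fin k → ℂ) p).symm
      =ᶠ[nhds (extChartAt 𝓘(ℝ, Fin k → ℂ) p p)] fun w => shapeEnergy Γ w + energyShift Γ := by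
  filter_upwards [isOpen_shapes.mem_nhds (shapeChart_mem Γ p)] with w hw
  exact reducedHamiltonian_symm Γ hw

theorem IsCriticalPoint.fderiv_shapeEnergy_eq_zero {p : Reduced Γ}
    (hp : IsCriticalPoint (E := Fin k → ℂ) (reducedHamiltonian Γ) p) :
    fderiv ℝ (shapeEnergy Γ) (shapeChart Γ p) = 0 := by
  have hd := (contMDiff_reducedHamiltonian Γ p).mdifferentiableAt (by simp)
  have hchart : fderivWithin ℝ
      (writtenInExtChartAt 𝓘(ℝ, Fin k → ℂ) 𝓘(ℝ, ℝ) p (reducedHamiltonian Γ))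
      (Set.range 𝓘(ℝ, Fin k → ℂ)) (extChartAt 𝓘(ℝ, Fin k → ℂ) p p) = 0 :=
    hd.mfderiv.symm.trans hp
  simp only [writtenInExtChartAt, extChartAt_model_space_eq_id, modelWithCornersSelf_coe,
    Set.range_id, fderivWithin_univ, PartialEquiv.refl_coe, Function.id_comp] at hchart
  rwa [(reducedHamiltonian_comp_symm_eventuallyEq Γ p).fderiv_eq, fderiv_add_const] at hchart

theorem chartHessian_reducedHamiltonian (p : Reduced Γ) :
    chartHessian (reducedHamiltonian Γ) p =
      fderiv ℝ (fderiv ℝ (shapeEnergy Γ)) (shapeChart Γ p) := by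
  rw [chartHessian, (reducedHamiltonian_comp_symm_eventuallyEq Γ p).fderiv.fderiv_eq]
  have hfderiv : fderiv ℝ (fun w => shapeEnergy Γ w + energyShift Γ) = fderiv ℝ (shapeEnergy Γ) :=
    funext fun _ => fderiv_add_const _
  rw [hfderiv]
  rfl

variable {Γ}

theorem IsRigid.isMorse (hΓ : IsRigid Γ) :
    IsMorse (E := Fin k → ℂ) (reducedHamiltonian Γ) := by
  refine ⟨contMDiff_reducedHamiltonian Γ, fun p hp v hv => ?_⟩
  rw [chartHessian_reducedHamiltonian] at hv
  exact hΓ.eq_zero_of_fderiv_fderiv (shapeChart_mem Γ p) (hp.fderiv_shapeEnergy_eq_zero Γ) hv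

end ReducedHamiltonian

end Vortex

end

theorem lemma4p5 (m : ℝ) (hm0 : 0 < m) (hm1 : m < 1) :
    Vortex.IsMorse (E := Fin 2 → ℂ) (Vortex.reducedHamiltonian (Vortex.pairs m hm0)) :=
  Vortex.IsRigid.isMorse (Vortex.isRigid_pairs hm0 hm1)
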